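/- **Setting.** Let $N\ge 2$ and let $p,q>N$ be coprime integers. For an integer $n>N$ let $\Phi_N^n=\{\lambda\in\mathbb Z^{N-1}:\lambda_i>0,\ \lambda_1+\dots+\lambda_{N-1}<n\}$, $\lambda_0:=n-\lambda_1-\dots-\lambda_{N-1}$, $\rho=(1,\dots,1)$, $t(\lambda)=\sum_{j} j\lambda_j$, and $J(\lambda_1,\dots,\lambda_{N-1})=(\lambda_0,\lambda_1,\dots,\lambda_{N-2})$. Put $\lambda[i]=\sum_{i\le\ell<N}\lambda_\ell$ $(1\le i\le N)$, $$\lambda\cdot\mu=\sum_{1\le i<N}\tfrac{i(N-i)}{N}\lambda_i\mu_i+\sum_{1\le i<j<N}\tfrac{i(N-j)}{N}(\lambda_i\mu_j+\lambda_j\mu_i),\qquad \lambda^2=\lambda\cdot\lambda,$$ and, for a rational $h>0$, $$S^{(N;h)}_{\lambda\kappa}=\exp\Big[\frac{2\pi \mathrm i\,t(\lambda)t(\kappa)}{Nh}\Big]\det\Big(\exp\big[-2\pi \mathrm i\,\lambda[i]\kappa[j]/h\big]\Big)_{1\le i,j\le N},\qquad T^{(N;n)}_{\lambda\lambda}=\exp[\pi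 \mathrm i\lambda^2/n].$$ For a finite set $\Phi$ with a distinguished element $0$ (the vacuum) and $\Phi\times\Phi$ matrices $S,T$, a *modular invariant* is a $\Phi\times\Phi$ matrix $M$ with $M_{00}=1$, all entries in $\mathbb Z_{\ge0}$, $SM=MS$ and $TM=MT$. * $SU(N)\times SU(N)$ at height $(p,q)$: $\Phi=\Phi_N^{p,q}:=\Phi_N^p\times\Phi_N^q$, with elements written $\lambda\mu$; the vacuum is $\rho\rho$; $S_{\lambda\mu,\kappa\nu}=c\,S^{(N;p)}_{\lambda\kappa}S^{(N;q)}_{\mu\nu}$; $T$ is diagonal with $T_{\lambda\mu,\lambda\mu}=c'\,T^{(N;p)}_{\lambda\lambda}T^{(N;q)}_{\mu\mu}$. Write $J$, $K$ for the above permutation acting on the first, respectively the second, factor. * $W_N(p,q)$: $\Phi$ is the set of orbits $[\lambda\mu]$ of $JK$ in $\Phi_N^{p,q}$; the vacuum is $[\rho\rho]$; $$S_{[\lambda\mu][\kappa\nu]}=\alpha'\exp\Big[-2\pi \mathrm i\,\tfrac{t(\lambda)t(\nu)+t(\mu)t(\kappa)}{N}\Big]S^{(N;p/q)}_{\lambda\kappa}S^{(N;q/p)}_{\mu\nu},$$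 and $T$ is diagonal with $T_{[\lambda\mu][\lambda\mu]}=\beta'\exp[\pi \mathrm i\,(q\lambda-p\mu)^2/(pq)]$. Here $c,c',\alpha',\beta'$ are arbitrary nonzero normalising constants. They do not affect which matrices are modular invariants. Call an integer $r$ *$pq$-admissible* if $rp-q$ and $r^2p+q$ are both coprime to $2N$; for such $r$ let $\Phi_{WN}^{p,q}=\{\lambda\mu\in\Phi_N^{p,q}: t(\mu)\equiv r\,t(\lambda)\pmod N\}$. **Theorem.** Fix any $pq$-admissible integer $r$. Let $M$ be any modular invariant for $W_N(p,q)$. Then the formula $$\widetilde M_{J^{ar}\lambda K^{-a}\mu,\ J^{br}\kappa K^{-b}\nu}=\delta_{ab}\,M_{[\lambda\mu][\kappa\nu]}\qquad(\lambda\mu,\kappa\nu\in\Phi_{WN}^{p,q},\ 0\le a,b<N)$$ determines a unique well-defined matrix $\widetilde M$ indexed by $\Phi_N^{p,q}$, and $\widetilde M$ is an $SU(N)\times SU(N)$ modular invariant at height $(p,q)$. Conversely, an $SU(N)\times SU(N)$ modular invariant $\widetilde M$ at height $(p,q)$ is associated in this way to a $W_N(p,q)$ modular invariant $M$ if and only if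 $$\widetilde M_{J^{-r}\rho K\rho,\ J^{-r}\rho K\rho}=1,$$ and $M$ is then unique. Hence $M\mapsto\widetilde M$ is a bijection from the set of $W_N(p,q)$ modular invariants onto the set of $SU(N)\times SU(N)$ modular invariants at height $(p,q)$ with $\widetilde M_{J^{-r}\rho K\rho,\,J^{-r}\rho K\rho}=1$. -/

import Mathlib

namespace WNModular

open Complex

/-! ### Modular invariants -/

/-- `M` is a modular invariant for the modular data `S`, `T` with vacuum `vac`: uniqueness of the
vacuum, integrality and nonnegativity, and commutation with `S` and `T`. -/
structure IsModularInvariant {Φ : Type*} [Fintype Φ] (S T : Matrix Φ Φ ℂ) (vac : Φ)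
    (M : Matrix Φ Φ ℂ) : Prop where
  vacuum : M vac vac = 1
  nonneg_integral : ∀ x y, ∃ m : ℕ, M x y = (m : ℂ)
  S_comm : S * M = M * S
  T_comm : T * M = M * T

/-! ### Weights of `SU(N)` at height `n` -/

/-- The primaries of `SU(N)` at height `n`, shifted by the Weyl vector, as vectors of extended
Dynkin labels `(λ_0, λ_1, …, λ_{N-1})`: positive integers of sum `n`. The label `λ_0` is redundant,
`λ_0 = n - λ_1 - ⋯ - λ_{N-1}`, and its positivity says `λ_1 + ⋯ + λ_{N-1} < n`. -/
@[ext]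
structure Weight (N n : ℕ) where
  label : Fin N → ℤ
  pos : ∀ i, 0 < label i
  sum_eq : ∑ i, label i = (n : ℤ)

instance (N n : ℕ) : Finite (Weight N n) := by
  have hfin : (Set.Icc (0 : Fin N → ℤ) (fun _ => (n : ℤ))).Finite := Set.finite_Icc _ _
  have hmem : ∀ l : Weight N n, l.label ∈ Set.Icc (0 : Fin N → ℤ) (fun _ => (n : ℤ)) := by
    refine fun l => ⟨fun i => (l.pos i).le, fun i => ?_⟩
    simp only [← l.sum_eq]
    exact Finset.single_le_sum (fun j _ => (l.pos j).le) (Finset.mem_univ i)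
  have := hfin.to_subtype
  exact Finite.of_injective
    (fun l => (⟨l.label, hmem l⟩ : Set.Icc (0 : Fin N → ℤ) (fun _ => (n : ℤ))))
    (fun l k h => Weight.ext (congrArg Subtype.val h))

noncomputable instance (N n : ℕ) : Fintype (Weight N n) := Fintype.ofFinite _

noncomputable instance (N n : ℕ) : DecidableEq (Weight N n) := Classical.decEq _

/-- The vacuum of `SU(N)` at height `n`: the Weyl vector `ρ = (1, …, 1)`. -/
def rho {N n : ℕ} (hN : 2 ≤ N) (hn : N < n) : Weight N n where
  label i := if i.val = 0 then (n : ℤ) - (N - 1) else 1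
  pos i := by split_ifs <;> omega
  sum_eq := by
    obtain ⟨m, rfl⟩ : ∃ m, N = m + 1 := ⟨N - 1, by omega⟩
    rw [Fin.sum_univ_succ]
    simp

/-- The simple-current `J (λ_1, …, λ_{N-1}) = (λ_0, λ_1, …, λ_{N-2})`, a permutation of the
weights: it rotates the extended Dynkin labels by one step, `(J λ)_i = λ_{i-1}`. -/
def J (N n : ℕ) : Equiv.Perm (Weight N n) where
  toFun l := ⟨l.label ∘ (finRotate N).symm, fun _ => l.pos _,
    (Equiv.sum_comp (finRotate N).symm l.label).trans l.sum_eq⟩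
  invFun l := ⟨l.label ∘ finRotate N, fun _ => l.pos _,
    (Equiv.sum_comp (finRotate N) l.label).trans l.sum_eq⟩
  left_inv l := by
    ext i
    exact congrArg l.label ((finRotate N).symm_apply_apply i)
  right_inv l := by
    ext i
    exact congrArg l.label ((finRotate N).apply_symm_apply i)

/-! ### Modular data of `SU(N)` at height `n`

The next functions are defined on all vectors of extended Dynkin labels; none of them
depends on the label at index `0`. -/

/-- The `N`-ality `t(λ) = ∑_{1 ≤ j < N} j λ_j`. -/
def nality {N : ℕ} (l : Fin N → ℤ) : ℤ := ∑ j : Fin N, (j.val : ℤ) * l j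

/-- The partial sums `λ[i] = ∑_{i ≤ ℓ < N} λ_ℓ` for `1 ≤ i ≤ N`. Here `i : Fin N` stands for
the index `i + 1`. -/
def bracket {N : ℕ} (l : Fin N → ℤ) (i : Fin N) : ℤ := ∑ k : Fin N, if i < k then l k else 0

/-- The inner product `λ · μ` of weights in terms of Dynkin labels. -/
noncomputable def form {N : ℕ} (l m : Fin N → ℤ) : ℚ :=
  ∑ i : Fin N, ((i.val : ℚ) * ((N : ℚ) - i.val) / N) * (l i * m i) +
    ∑ i : Fin N, ∑ j : Fin N,
      if i < j then ((i.val : ℚ) * ((N : ℚ) - j.val) / N) * (l i * m j + l j * m i) else 0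

/-- The entries `S^{(N;h)}_{λκ}` of the `SU(N)` matrix `S` at a height `h` that may be fractional,
up to a normalising constant. -/
noncomputable def suS {N : ℕ} (h : ℚ) (l k : Fin N → ℤ) : ℂ :=
  exp (2 * Real.pi * I * ((nality l * nality k : ℤ) : ℂ) / ((N : ℂ) * (h : ℂ))) *
    (Matrix.of fun i j : Fin N =>
      exp (-(2 * Real.pi * I * ((bracket l i * bracket k j : ℤ) : ℂ) / (h : ℂ)))).det

/-- The entries `T^{(N;n)}_{λλ}` of the `SU(N)` matrix `T`, up to a normalising constant. -/
noncomputable def suT {N : ℕ} (n : ℕ) (l : Fin N → ℤ) : ℂ :=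
  exp (Real.pi * I * ((form l l : ℚ) : ℂ) / (n : ℂ))

/-! ### Modular data of `SU(N) × SU(N)` at height `(p, q)` -/

/-- The primaries of `SU(N) × SU(N)` at height `(p, q)`. -/
abbrev Weight2 (N p q : ℕ) : Type := Weight N p × Weight N q

/-- The vacuum `ρρ`. -/
def vacuum2 {N p q : ℕ} (hN : 2 ≤ N) (hp : N < p) (hq : N < q) : Weight2 N p q :=
  (rho hN hp, rho hN hq)

/-- The matrix `S` of `SU(N) × SU(N)`: the tensor product of the two `SU(N)` matrices, normalised
by the constants `βp` and `βq`. -/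
noncomputable def S2 (N p q : ℕ) (βp βq : ℂ) : Matrix (Weight2 N p q) (Weight2 N p q) ℂ :=
  Matrix.of fun x y => (βp * suS (p : ℚ) x.1.label y.1.label) * (βq * suS (q : ℚ) x.2.label y.2.label)

/-- The diagonal matrix `T` of `SU(N) × SU(N)`: the tensor product of the two `SU(N)` matrices,
normalised by the constants `αp` and `αq`. -/
noncomputable def T2 (N p q : ℕ) (αp αq : ℂ) : Matrix (Weight2 N p q) (Weight2 N p q) ℂ :=
  Matrix.diagonal fun x => (αp * suT p x.1.label) * (αq * suT q x.2.label)

/-! ### `W_N(p,q)` primaries -/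

/-- The simple-current `JK`: the rotation of both components of a weight of `SU(N) × SU(N)`. -/
def JK (N p q : ℕ) : Equiv.Perm (Weight2 N p q) := (J N p).prodCongr (J N q)

/-- The primaries of `W_N(p,q)`: the `JK`-orbits in the set of weights of `SU(N) × SU(N)`. -/
def WPrimary (N p q : ℕ) : Type := Quotient (Equiv.Perm.SameCycle.setoid (JK N p q))

/-- The orbit `[λμ]`. -/
def orbit {N p q : ℕ} (x : Weight2 N p q) : WPrimary N p q :=
  Quotient.mk (Equiv.Perm.SameCycle.setoid (JK N p q)) x

instance (N p q : ℕ) : Finite (WPrimary N p q) :=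
  inferInstanceAs (Finite (Quotient (Equiv.Perm.SameCycle.setoid (JK N p q))))

noncomputable instance (N p q : ℕ) : Fintype (WPrimary N p q) := Fintype.ofFinite _

noncomputable instance (N p q : ℕ) : DecidableEq (WPrimary N p q) := Classical.decEq _

/-- The `W_N(p,q)` matrix `S` (up to a normalising constant), on representatives `λμ`, `κν`. -/
noncomputable def wSrep {N p q : ℕ} (x y : Weight2 N p q) : ℂ :=
  exp (-(2 * Real.pi * I *
      ((nality x.1.label * nality y.2.label + nality x.2.label * nality y.1.label : ℤ) : ℂ) / (N : ℂ))) *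
    suS ((p : ℚ) / (q : ℚ)) x.1.label y.1.label * suS ((q : ℚ) / (p : ℚ)) x.2.label y.2.label

/-- The `W_N(p,q)` matrix `T` (up to a normalising constant), on a representative `λμ`. -/
noncomputable def wTrep {N p q : ℕ} (x : Weight2 N p q) : ℂ :=
  exp (Real.pi * I *
    ((form (fun i => (q : ℤ) * x.1.label i - (p : ℤ) * x.2.label i)
      (fun i => (q : ℤ) * x.1.label i - (p : ℤ) * x.2.label i) : ℚ) : ℂ) / ((p : ℂ) * (q : ℂ)))

/-! Both are constant on the `JK`-orbits. -/

theorem suS_comm {N : ℕ} (h : ℚ) (l k : Fin N → ℤ) : suS h l k = suS h k l := by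
  unfold suS
  rw [← Matrix.det_transpose, mul_comm (nality l)]
  congr 2
  ext i j
  simp [Matrix.transpose_apply, mul_comm]

theorem wSrep_comm {N p q : ℕ} (x y : Weight2 N p q) : wSrep x y = wSrep y x := by
  unfold wSrep
  rw [suS_comm _ x.1.label, suS_comm _ x.2.label]
  congr 5
  push_cast
  ring

theorem bracket_rot {m : ℕ} (l : Fin (m + 1) → ℤ) (i : Fin (m + 1)) :
    bracket (l ∘ (finRotate (m + 1)).symm) (finRotate (m + 1) i) =
      bracket l i - l (Fin.last m) + if i = Fin.last m then ∑ k, l k else 0 := by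
  unfold bracket
  rw [← Equiv.sum_comp (finRotate (m + 1))]
  simp only [Function.comp_apply, Equiv.symm_apply_apply]
  have key : ∀ k : Fin (m + 1),
      (if finRotate (m + 1) i < finRotate (m + 1) k then l k else 0) =
        ((if i < k then l k else 0) - if k = Fin.last m then l k else 0) +
          if i = Fin.last m then l k else 0 := by
    intro k
    by_cases hi : i = Fin.last m
    · subst hi
      by_cases hk : k = Fin.last m
      · subst hk; simp
      · have h1 : (finRotate (m + 1) k).val = k.val + 1 :=
          coe_finRotate_of_ne_last hk
        have h2 : ¬ Fin.last m < k := not_lt.mpr (Fin.le_last k)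
        have h3 : finRotate (m + 1) (Fin.last m) < finRotate (m + 1) k := by
          rw [Fin.lt_def, h1, finRotate_last]
          simp
        rw [if_pos h3, if_neg h2, if_neg hk, if_pos rfl]
        ring
    · have h0 : (finRotate (m + 1) i).val = i.val + 1 := coe_finRotate_of_ne_last hi
      by_cases hk : k = Fin.last m
      · subst hk
        have h2 : i < Fin.last m := Fin.lt_last_iff_ne_last.mpr hi
        simp [hi, h2]
      · have h1 : (finRotate (m + 1) k).val = k.val + 1 :=
          coe_finRotate_of_ne_last hk
        have h3 : (finRotate (m + 1) i < finRotate (m + 1) k) = (i < k) := by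
          rw [Fin.lt_def, Fin.lt_def, h0, h1, add_lt_add_iff_right]
        simp only [h3, if_neg hi, if_neg hk]
        ring
  rw [Finset.sum_congr rfl (fun k _ => key k), Finset.sum_add_distrib, Finset.sum_sub_distrib]
  congr 1
  · simp
  · split_ifs <;> simp

theorem nality_eq_sum_bracket {N : ℕ} (l : Fin N → ℤ) : nality l = ∑ i, bracket l i := by
  unfold nality bracket
  rw [Finset.sum_comm]
  refine Finset.sum_congr rfl fun k _ => ?_
  rw [← Finset.sum_filter, Finset.sum_const]
  have h1 : (Finset.univ.filter fun a : Fin N => a < k) = Finset.Iio k := by ext; simp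
  rw [h1, Fin.card_Iio]
  simp

theorem nality_rot {m : ℕ} (l : Fin (m + 1) → ℤ) :
    nality (l ∘ (finRotate (m + 1)).symm) =
      nality l - ((m + 1 : ℕ) : ℤ) * l (Fin.last m) + ∑ k, l k := by
  rw [nality_eq_sum_bracket, nality_eq_sum_bracket, ← Equiv.sum_comp (finRotate (m + 1))]
  simp only [bracket_rot, Finset.sum_add_distrib, Finset.sum_sub_distrib]
  simp

/-- `S_{Jλ,κ} = (-1)^{N-1} exp(2πi d t(κ)/N) S_{λκ}` at height `n / d`. -/
theorem suS_J {m n : ℕ} (h : ℚ) (d : ℤ) (hh : h ≠ 0) (hd : (n : ℚ) = d * h)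
    (l : Weight (m + 1) n) (k : Fin (m + 1) → ℤ) :
    suS h (J (m + 1) n l).label k =
      (-1) ^ m * exp (2 * Real.pi * I * ((d * nality k : ℤ) : ℂ) / ((m + 1 : ℕ) : ℂ)) *
        suS h l.label k := by
  have hhC : (h : ℂ) ≠ 0 := by exact_mod_cast hh
  have hdC : (n : ℂ) = d * h := by exact_mod_cast hd
  have hm : ((m + 1 : ℕ) : ℂ) ≠ 0 := by exact_mod_cast Nat.succ_ne_zero m
  have hJ : (J (m + 1) n l).label = l.label ∘ (finRotate (m + 1)).symm := rfl
  have hsum : ∑ i, l.label i = (n : ℤ) := l.sum_eq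
  unfold suS
  rw [hJ]
  set A : Matrix (Fin (m + 1)) (Fin (m + 1)) ℂ := Matrix.of fun i j =>
    exp (-(2 * Real.pi * I * ((bracket l.label i * bracket k j : ℤ) : ℂ) / (h : ℂ))) with hA
  set B : Matrix (Fin (m + 1)) (Fin (m + 1)) ℂ := Matrix.of fun i j =>
    exp (-(2 * Real.pi * I *
      ((bracket (l.label ∘ (finRotate (m + 1)).symm) i * bracket k j : ℤ) : ℂ) / (h : ℂ))) with hB
  have hBA : B.submatrix (finRotate (m + 1)) id = Matrix.of fun i j =>
      exp (2 * Real.pi * I * ((l.label (Fin.last m) * bracket k j : ℤ) : ℂ) / (h : ℂ)) * A i j := by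
    ext i j
    simp only [hA, hB, Matrix.submatrix_apply, Matrix.of_apply, id, bracket_rot, hsum]
    rw [← exp_add, exp_eq_exp_iff_exists_int]
    by_cases hi : i = Fin.last m
    · refine ⟨-(d * bracket k j), ?_⟩
      simp only [hi, if_true]
      push_cast
      rw [hdC]
      field_simp
      ring
    · refine ⟨0, ?_⟩
      simp only [hi, if_false]
      push_cast
      field_simp
      ring
  have hdet : B.det = (-1) ^ m *
      exp (2 * Real.pi * I * ((l.label (Fin.last m) * nality k : ℤ) : ℂ) / (h : ℂ)) * A.det := by
    have h1 := Matrix.det_permute (finRotate (m + 1)) B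
    have h2 : (B.submatrix (finRotate (m + 1)) id).det =
        exp (2 * Real.pi * I * ((l.label (Fin.last m) * nality k : ℤ) : ℂ) / (h : ℂ)) * A.det := by
      rw [hBA, Matrix.det_mul_row, ← exp_sum]
      congr 2
      rw [nality_eq_sum_bracket]
      push_cast
      rw [← Finset.sum_div, ← Finset.mul_sum, ← Finset.mul_sum]
    rw [h2, sign_finRotate] at h1
    have h3 : ((-1 : ℂ) ^ m) * ((-1) ^ m) = 1 := by rw [← mul_pow]; simp
    rw [mul_assoc, h1]
    push_cast
    rw [← mul_assoc, h3, one_mul]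
  rw [hdet, nality_rot, hsum]
  have hexp : exp (2 * Real.pi * I *
        (((nality l.label - ((m + 1 : ℕ) : ℤ) * l.label (Fin.last m) + n) * nality k : ℤ) : ℂ) /
        (((m + 1 : ℕ) : ℂ) * (h : ℂ))) *
      exp (2 * Real.pi * I * ((l.label (Fin.last m) * nality k : ℤ) : ℂ) / (h : ℂ)) =
      exp (2 * Real.pi * I * ((d * nality k : ℤ) : ℂ) / ((m + 1 : ℕ) : ℂ)) *
      exp (2 * Real.pi * I * ((nality l.label * nality k : ℤ) : ℂ) /
        (((m + 1 : ℕ) : ℂ) * (h : ℂ))) := by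
    rw [← exp_add, ← exp_add]
    congr 1
    rw [Int.cast_mul (_ + _)]
    push_cast at hm ⊢
    rw [hdC]
    field_simp
    ring
  linear_combination ((-1) ^ m * A.det) * hexp

theorem wSrep_JK {N p q : ℕ} (hp : p ≠ 0) (hq : q ≠ 0) (x y : Weight2 N p q) :
    wSrep (JK N p q x) y = wSrep x y := by
  obtain _ | m := N
  · have h1 : JK 0 p q x = x :=
      Prod.ext (Weight.ext (Subsingleton.elim _ _)) (Weight.ext (Subsingleton.elim _ _))
    rw [h1]
  have hp' : (p : ℚ) ≠ 0 := by exact_mod_cast hp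
  have hq' : (q : ℚ) ≠ 0 := by exact_mod_cast hq
  have hm : ((m + 1 : ℕ) : ℂ) ≠ 0 := by exact_mod_cast Nat.succ_ne_zero m
  have e1 : (JK (m + 1) p q x).1 = J (m + 1) p x.1 := rfl
  have e2 : (JK (m + 1) p q x).2 = J (m + 1) q x.2 := rfl
  have t1 : nality (J (m + 1) p x.1).label = _ := nality_rot x.1.label
  have t2 : nality (J (m + 1) q x.2).label = _ := nality_rot x.2.label
  unfold wSrep
  rw [e1, e2, suS_J (p / q : ℚ) q (div_ne_zero hp' hq') (by push_cast; field_simp),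
    suS_J (q / p : ℚ) p (div_ne_zero hq' hp') (by push_cast; field_simp), t1, t2,
    x.1.sum_eq, x.2.sum_eq]
  have h3 : ((-1 : ℂ) ^ m) * ((-1) ^ m) = 1 := by rw [← mul_pow]; simp
  have hexp : exp (-(2 * Real.pi * I *
        (((nality x.1.label - ((m + 1 : ℕ) : ℤ) * x.1.label (Fin.last m) + p) * nality y.2.label +
          (nality x.2.label - ((m + 1 : ℕ) : ℤ) * x.2.label (Fin.last m) + q) * nality y.1.label : ℤ) : ℂ) /
          ((m + 1 : ℕ) : ℂ))) *
      exp (2 * Real.pi * I * ((q * nality y.1.label : ℤ) : ℂ) / ((m + 1 : ℕ) : ℂ)) *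
      exp (2 * Real.pi * I * ((p * nality y.2.label : ℤ) : ℂ) / ((m + 1 : ℕ) : ℂ)) =
      exp (-(2 * Real.pi * I *
        ((nality x.1.label * nality y.2.label + nality x.2.label * nality y.1.label : ℤ) : ℂ) /
          ((m + 1 : ℕ) : ℂ))) := by
    rw [← exp_add, ← exp_add, exp_eq_exp_iff_exists_int]
    refine ⟨x.1.label (Fin.last m) * nality y.2.label + x.2.label (Fin.last m) * nality y.1.label, ?_⟩
    push_cast at hm ⊢
    field_simp
    ring
  rw [← hexp]
  generalize exp (-(2 * Real.pi * I * _ / ((m + 1 : ℕ) : ℂ))) = e1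
  generalize exp (2 * Real.pi * I * _ / ((m + 1 : ℕ) : ℂ)) = e2
  generalize exp (2 * Real.pi * I * _ / ((m + 1 : ℕ) : ℂ)) = e3
  linear_combination (e1 * e2 * e3 * suS (p / q : ℚ) x.1.label y.1.label *
    suS (q / p : ℚ) x.2.label y.2.label) * h3

theorem sum_sum_eq_diag_add {N : ℕ} (g : Fin N → Fin N → ℚ) :
    ∑ i, ∑ j, g i j = ∑ i, g i i + ∑ i, ∑ j, if i < j then g i j + g j i else 0 := by
  have h1 : ∀ i j : Fin N, g i j = (if i < j then g i j else 0) + (if i = j then g i j else 0) +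
      (if j < i then g i j else 0) := by
    intro i j
    rcases lt_trichotomy i j with h | h | h
    · simp [h, h.ne, h.not_gt]
    · simp [h]
    · simp [h, h.ne', h.not_gt]
  have h2 : ∀ i j : Fin N, (if i < j then g i j + g j i else 0) =
      (if i < j then g i j else 0) + (if i < j then g j i else 0) := by
    intro i j
    split_ifs <;> simp
  have h3 : ∑ i, ∑ j, g i j = ∑ i : Fin N, ∑ j : Fin N, ((if i < j then g i j else 0) +
      (if i = j then g i j else 0) + (if j < i then g i j else 0)) :=
    Finset.sum_congr rfl fun i _ => Finset.sum_congr rfl fun j _ => h1 i j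
  rw [h3]
  simp only [h2, Finset.sum_add_distrib]
  rw [Finset.sum_comm (f := fun i j : Fin N => if j < i then g i j else 0)]
  simp
  ring

theorem form_eq {N : ℕ} (hN : N ≠ 0) (l : Fin N → ℤ) :
    form l l = ((∑ i, bracket l i ^ 2 : ℤ) : ℚ) - ((nality l ^ 2 : ℤ) : ℚ) / N := by
  have hN' : (N : ℚ) ≠ 0 := by exact_mod_cast hN
  have hb : (∑ i, bracket l i ^ 2 : ℤ) = ∑ i : Fin N, ∑ j : Fin N,
      (min i.val j.val : ℤ) * (l i * l j) := by
    have h1 : ∀ a, bracket l a ^ 2 =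
        ∑ i : Fin N, ∑ j : Fin N, if a < i ∧ a < j then l i * l j else 0 := by
      intro a
      unfold bracket
      rw [sq, Finset.sum_mul_sum]
      refine Finset.sum_congr rfl fun i _ => Finset.sum_congr rfl fun j _ => ?_
      by_cases hi : a < i <;> by_cases hj : a < j <;> simp [hi, hj]
    simp only [h1]
    rw [Finset.sum_comm]
    refine Finset.sum_congr rfl fun i _ => ?_
    rw [Finset.sum_comm]
    refine Finset.sum_congr rfl fun j _ => ?_
    rw [← Finset.sum_filter, Finset.sum_const]
    have h2 : (Finset.univ.filter fun a : Fin N => a < i ∧ a < j) = Finset.Iio (min i j) := by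
      ext; simp
    rw [h2, Fin.card_Iio, nsmul_eq_mul]
    congr 1
    rcases le_total i j with h | h
    · rw [min_eq_left h, min_eq_left (by exact_mod_cast h)]
    · rw [min_eq_right h, min_eq_right (by exact_mod_cast h)]
  have ht : ((nality l ^ 2 : ℤ) : ℚ) / N = ∑ i : Fin N, ∑ j : Fin N,
      ((i.val : ℚ) * j.val / N) * (l i * l j) := by
    unfold nality
    rw [sq, Finset.sum_mul_sum]
    push_cast
    rw [Finset.sum_div]
    refine Finset.sum_congr rfl fun i _ => ?_
    rw [Finset.sum_div]
    refine Finset.sum_congr rfl fun j _ => by ring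
  rw [hb, ht]
  push_cast
  rw [← Finset.sum_sub_distrib]
  simp only [← Finset.sum_sub_distrib]
  rw [sum_sum_eq_diag_add]
  unfold form
  congr 1
  · refine Finset.sum_congr rfl fun i _ => ?_
    rw [min_self]
    field_simp
  · refine Finset.sum_congr rfl fun i _ => Finset.sum_congr rfl fun j _ => ?_
    split_ifs with h
    · have h' : (i.val : ℚ) ≤ j.val := by exact_mod_cast h.le
      rw [min_eq_left h', min_eq_right h']
      field_simp
    · rfl

theorem form_rot {m : ℕ} (l : Fin (m + 1) → ℤ) (hl : ∑ i, l i = 0) :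
    form (l ∘ (finRotate (m + 1)).symm) (l ∘ (finRotate (m + 1)).symm) = form l l := by
  have hm : (m : ℚ) + 1 ≠ 0 := by positivity
  rw [form_eq (Nat.succ_ne_zero m), form_eq (Nat.succ_ne_zero m), nality_rot, hl,
    ← Equiv.sum_comp (finRotate (m + 1))]
  simp only [bracket_rot, hl, ite_self, add_zero]
  have h1 : ∑ i, (bracket l i - l (Fin.last m)) ^ 2 =
      ∑ i, bracket l i ^ 2 - 2 * l (Fin.last m) * nality l + (m + 1) * l (Fin.last m) ^ 2 := by
    simp only [sub_sq, Finset.sum_add_distrib, Finset.sum_sub_distrib, nality_eq_sum_bracket,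
      Finset.mul_sum]
    simp
    refine Finset.sum_congr rfl fun _ _ => by ring
  rw [h1]
  push_cast
  field_simp
  ring

theorem wTrep_JK {N p q : ℕ} (x : Weight2 N p q) : wTrep (JK N p q x) = wTrep x := by
  obtain _ | m := N
  · have h1 : JK 0 p q x = x :=
      Prod.ext (Weight.ext (Subsingleton.elim _ _)) (Weight.ext (Subsingleton.elim _ _))
    rw [h1]
  unfold wTrep
  have h := form_rot (fun i => (q : ℤ) * x.1.label i - (p : ℤ) * x.2.label i) (by
    rw [Finset.sum_sub_distrib, ← Finset.mul_sum, ← Finset.mul_sum, x.1.sum_eq, x.2.sum_eq]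
    ring)
  exact congrArg (fun z : ℚ => exp (Real.pi * I * (z : ℂ) / ((p : ℂ) * (q : ℂ)))) h

theorem eq_of_sameCycle {α β : Type*} {f : Equiv.Perm α} {g : α → β} (hg : ∀ x, g (f x) = g x)
    {x y : α} (h : f.SameCycle x y) : g x = g y := by
  obtain ⟨i, rfl⟩ := h
  induction i using Int.induction_on with
  | zero => simp
  | succ i ih => rw [add_comm, zpow_add, zpow_one, Equiv.Perm.mul_apply, hg, ih]
  | pred i ih =>
    rw [ih, ← hg ((f ^ (-(i : ℤ) - 1)) x), ← Equiv.Perm.mul_apply, ← zpow_one_add]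
    congr 3
    ring

/-- The `W_N(p,q)` matrix `S`, with normalising constant `α'`. -/
noncomputable def wS (N p q : ℕ) (hp : N < p) (hq : N < q) (α' : ℂ) :
    Matrix (WPrimary N p q) (WPrimary N p q) ℂ :=
  Matrix.of fun X Y => α' * Quotient.liftOn₂ X Y wSrep (by
    intro x y x' y' hx hy
    have hp0 : p ≠ 0 := by omega
    have hq0 : q ≠ 0 := by omega
    calc wSrep x y = wSrep x' y :=
          eq_of_sameCycle (g := fun z => wSrep z y) (fun z => wSrep_JK hp0 hq0 z y) hx
      _ = wSrep x' y' :=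
          eq_of_sameCycle (g := fun z => wSrep x' z)
            (fun z => by rw [wSrep_comm, wSrep_JK hp0 hq0, wSrep_comm]) hy)

/-- The diagonal `W_N(p,q)` matrix `T`, with normalising constant `β'`. -/
noncomputable def wT (N p q : ℕ) (β' : ℂ) : Matrix (WPrimary N p q) (WPrimary N p q) ℂ :=
  Matrix.diagonal fun X => β' * Quotient.liftOn X wTrep (fun _ _ h => eq_of_sameCycle wTrep_JK h)

/-! ### The correspondence -/

/-- `r` is `pq`-admissible: `rp - q` and `r²p + q` are coprime to `2N`. -/
def Admissible (N p q : ℕ) (r : ℤ) : Prop :=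
  IsCoprime (r * p - q) (2 * N : ℤ) ∧ IsCoprime (r ^ 2 * p + q) (2 * N : ℤ)

/-- The set `Φ_{WN}^{p,q}` of weights `λμ` with `t(μ) ≡ r t(λ)` modulo `N`. -/
def WReps (N p q : ℕ) (r : ℤ) : Set (Weight2 N p q) :=
  {x | nality x.2.label ≡ r * nality x.1.label [ZMOD N]}

/-- The action of the simple-current `J^i K^j` on the weights of `SU(N) × SU(N)`. -/
def JKpow {N p q : ℕ} (i j : ℤ) (x : Weight2 N p q) : Weight2 N p q :=
  ((J N p ^ i) x.1, (J N q ^ j) x.2)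

/-- The entries of the `SU(N) × SU(N)` matrix `Mt` are obtained from the `W_N(p,q)` matrix `M` by
`Mt_{J^{ar}λ K^{-a}μ, J^{br}κ K^{-b}ν} = δ_{ab} M_{[λμ][κν]}`. -/
def IsLift {N p q : ℕ} (r : ℤ) (M : Matrix (WPrimary N p q) (WPrimary N p q) ℂ)
    (Mt : Matrix (Weight2 N p q) (Weight2 N p q) ℂ) : Prop :=
  ∀ x ∈ WReps N p q r, ∀ y ∈ WReps N p q r, ∀ a b : ℕ, a < N → b < N →
    Mt (JKpow (a * r) (-a) x) (JKpow (b * r) (-b) y) = if a = b then M (orbit x) (orbit y) else 0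

/-- The modular invariants of `SU(N) × SU(N)` at height `(p, q)`. They do not depend on the
nonzero normalising constants. -/
def SU2Invariants (N p q : ℕ) (hN : 2 ≤ N) (hp : N < p) (hq : N < q) (αp αq βp βq : ℂ) :
    Set (Matrix (Weight2 N p q) (Weight2 N p q) ℂ) :=
  {Mt | IsModularInvariant (S2 N p q βp βq) (T2 N p q αp αq) (vacuum2 hN hp hq) Mt}

/-- The modular invariants of `W_N(p,q)`; the vacuum is `[ρρ]`. They do not depend on the
nonzero normalising constants. -/
def WInvariants (N p q : ℕ) (hN : 2 ≤ N) (hp : N < p) (hq : N < q) (α' β' : ℂ) :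
    Set (Matrix (WPrimary N p q) (WPrimary N p q) ℂ) :=
  {M | IsModularInvariant (wS N p q hp hq α') (wT N p q β') (orbit (vacuum2 hN hp hq)) M}

end WNModular

open WNModular

/-!
The `W_N(p,q)` modular data is, on the set of representatives `Φ_{WN}^{p,q}`, a Galois conjugate of
the `SU(N) × SU(N)` modular data, and `SU(N) × SU(N)` is tiled by the translates of `Φ_{WN}^{p,q}`
under the simple current `J^{-r} K`.

*Galois conjugation.* Admissibility of `r` makes `(r + 1)² + k (r² p + q) ≡ 0` solvable for `k`
modulo `N`, with a parity condition modulo `2N`, and `ℓ = p + q + pqk` is then coprime to `2Npq`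
because `ℓ (r² p + q) ≡ (rp - q)²` modulo `N` (`exists_isGaloisExponent`). Raising the roots of
unity to the power `ℓ` turns the matrices `S` and `T` of `SU(N) × SU(N)`, restricted to
`Φ_{WN}^{p,q}`, into those of `W_N(p,q)` (`fieldS_exp_pow`, `two_mul_dvd_wTExponent_sub`). A matrix
of integers commutes with the first pair if and only if it commutes with the second
(`wSrep_comm_iff`, `wTrep_eq_iff`).

*Tiling.* The charge `t(μ) - r t(λ)` modulo `N` changes by the unit `r² p + q` under `J^{-r} K`, and
by the unit `q - rp` under `JK`. So every orbit of either permutation meets `Φ_{WN}^{p,q}` exactly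
once. The lifts of `W_N(p,q)` matrices are thus the matrices that preserve the charge and are
invariant under `J^{-r} K` (`IsBlock`). In terms of this tiling, `S` is the Kronecker product of its
restriction with a matrix without zeros, so commutation may be tested on `Φ_{WN}^{p,q}`
(`IsBlock.S_comm_iff`, `IsBlock.T_comm_iff`).

*Recognising the lifts.* The matrix `S` of `SU(N)` is unitary up to a constant (`sum_suS_mul_conj`),
and its vacuum row is positive up to a constant (`exists_suS_rho`). If the diagonal entries of an
invariant at `ρρ` and at its image under a simple current agree, comparing the two sums that express
them through `S` shows that the invariant preserves the charge of this simple current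
(`simpleCurrent_charge_eq`), and then it is invariant under the simple current as well
(`apply_simpleCurrent_eq`).

*The vacuum.* If `N` and `r` are even, `ρρ` is not in `Φ_{WN}^{p,q}`, and the representative of
`[ρρ]` lies in the `J^{-r} K`-orbit of `J^{N/2} ρ ρ` rather than in that of `ρρ`. The charge of
`J^{N/2}` is the parity of `t(λ)`, which is determined by the eigenvalue of `T` and the charge
`t(μ) - r t(λ)`. So every lift is invariant under `J^{N/2}`, and its entry at the vacuum is still
that of the `W_N(p,q)` matrix (`IsLift.vacuum_eq`).
-/

namespace WNModular

open Complex

/-! ### Weights as strictly decreasing sequences -/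

theorem bracket_last {m : ℕ} (l : Fin (m + 1) → ℤ) : bracket l (Fin.last m) = 0 := by
  unfold bracket
  refine Finset.sum_eq_zero fun k _ => if_neg (not_lt.mpr (Fin.le_last k))

theorem bracket_castSucc {m : ℕ} (l : Fin (m + 1) → ℤ) (i : Fin m) :
    bracket l i.castSucc = l i.succ + bracket l i.succ := by
  unfold bracket
  have h : ∀ k : Fin (m + 1), (if i.castSucc < k then l k else 0) =
      (if k = i.succ then l k else 0) + if i.succ < k then l k else 0 := by
    intro k
    rcases lt_trichotomy k i.succ with h | h | h
    · have h1 : ¬ i.castSucc < k := by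
        rw [Fin.lt_def] at *; simp at *; omega
      simp [h1, h.ne, h.not_gt]
    · subst h; simp
    · have h1 : i.castSucc < k := by
        rw [Fin.lt_def] at *; simp at *; omega
      simp [h1, h.ne', h]
  simp only [h, Finset.sum_add_distrib]
  simp

theorem bracket_zero {m : ℕ} (l : Fin (m + 1) → ℤ) : bracket l 0 = ∑ k, l k - l 0 := by
  unfold bracket
  rw [Fin.sum_univ_succ, Fin.sum_univ_succ]
  simp

theorem Weight.bracket_strictAnti {m n : ℕ} (l : Weight (m + 1) n) :
    StrictAnti (bracket l.label) := by
  refine Fin.strictAnti_iff_succ_lt.mpr fun i => ?_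
  rw [bracket_castSucc]
  have := l.pos i.succ
  omega

theorem Weight.bracket_nonneg {m n : ℕ} (l : Weight (m + 1) n) (i : Fin (m + 1)) :
    0 ≤ bracket l.label i := by
  rw [← bracket_last l.label]
  exact l.bracket_strictAnti.antitone (Fin.le_last i)

theorem Weight.bracket_lt {m n : ℕ} (l : Weight (m + 1) n) (i : Fin (m + 1)) :
    bracket l.label i < n := by
  have h1 := l.bracket_strictAnti.antitone (Fin.zero_le i)
  have h2 := bracket_zero l.label
  have h3 := l.pos 0
  rw [l.sum_eq] at h2
  omega

theorem Weight.ext_bracket {m n : ℕ} {l k : Weight (m + 1) n}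
    (h : bracket l.label = bracket k.label) : l = k := by
  ext i
  refine Fin.cases ?_ (fun i => ?_) i
  · have h1 := bracket_zero l.label
    have h2 := bracket_zero k.label
    rw [l.sum_eq] at h1
    rw [k.sum_eq] at h2
    rw [h] at h1
    omega
  · have h1 := bracket_castSucc l.label i
    have h2 := bracket_castSucc k.label i
    rw [h] at h1
    omega

/-- The weight whose partial sums `λ[i]` are a given strictly decreasing sequence. -/
def Weight.ofBracket {m n : ℕ} (b : Fin (m + 1) → ℤ) (hb : StrictAnti b)
    (h0 : b 0 < n) (hlast : b (Fin.last m) = 0) : Weight (m + 1) n where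
  label := Fin.cons (n - b 0) fun i => b i.castSucc - b i.succ
  pos i := by
    refine Fin.cases ?_ (fun i => ?_) i
    · simpa using h0
    · simpa using hb i.castSucc_lt_succ
  sum_eq := by
    have h1 := Fin.sum_univ_succ b
    rw [Fin.sum_univ_castSucc] at h1
    rw [Fin.sum_univ_succ]
    simp only [Fin.cons_zero, Fin.cons_succ, Finset.sum_sub_distrib]
    omega

theorem Weight.bracket_ofBracket {m n : ℕ} (b : Fin (m + 1) → ℤ) (hb : StrictAnti b)
    (h0 : b 0 < n) (hlast : b (Fin.last m) = 0) :
    bracket (Weight.ofBracket b hb h0 hlast).label = b := by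
  funext i
  induction i using Fin.reverseInduction with
  | last => rw [bracket_last, hlast]
  | cast i ih =>
    rw [bracket_castSucc, ih]
    simp [Weight.ofBracket]

/-- The partial sums of a weight modulo the height. -/
def Weight.residue {m n : ℕ} (l : Weight (m + 1) n) (i : Fin (m + 1)) : ZMod n :=
  (bracket l.label i : ZMod n)

theorem intCast_zmod_inj {n : ℕ} {a b : ℤ} (ha : 0 ≤ a) (ha' : a < n) (hb : 0 ≤ b)
    (hb' : b < n) (h : (a : ZMod n) = b) : a = b := by
  rw [ZMod.intCast_eq_intCast_iff] at h
  have h' : a % n = b % n := h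
  rwa [Int.emod_eq_of_lt ha ha', Int.emod_eq_of_lt hb hb'] at h'

theorem Weight.residue_eq_iff {m n : ℕ} {l k : Weight (m + 1) n} {i j : Fin (m + 1)} :
    l.residue i = k.residue j ↔ bracket l.label i = bracket k.label j :=
  ⟨fun h => intCast_zmod_inj (l.bracket_nonneg i) (l.bracket_lt i) (k.bracket_nonneg j)
    (k.bracket_lt j) h, fun h => congrArg _ h⟩

theorem Weight.residue_injective {m n : ℕ} (l : Weight (m + 1) n) :
    Function.Injective l.residue := fun _ _ h =>
  l.bracket_strictAnti.injective (residue_eq_iff.mp h)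

theorem Weight.residue_last {m n : ℕ} (l : Weight (m + 1) n) :
    l.residue (Fin.last m) = 0 := by
  rw [Weight.residue, bracket_last, Int.cast_zero]

theorem Weight.ext_range {m n : ℕ} {l k : Weight (m + 1) n} {σ : Equiv.Perm (Fin (m + 1))}
    (h : ∀ i, bracket l.label (σ i) = bracket k.label i) : l = k := by
  refine Weight.ext_bracket ((l.bracket_strictAnti.range_inj k.bracket_strictAnti).mp ?_)
  have : bracket k.label = bracket l.label ∘ σ := funext fun i => (h i).symm
  rw [this, Set.range_comp, σ.surjective.range_eq, Set.image_univ]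

/-- Every injective tuple of nonzero residues modulo `n` is a rearrangement of the partial sums of
exactly one weight. -/
theorem sum_tuple_eq_sum_weight {m n : ℕ} [NeZero n] (G : (Fin m → ZMod n) → ℂ)
    (hperm : ∀ (σ : Equiv.Perm (Fin m)) k, G (k ∘ σ) = G k)
    (hzero : ∀ k, ¬ (Function.Injective k ∧ ∀ i, k i ≠ 0) → G k = 0) :
    ∑ k, G k = m.factorial * ∑ l : Weight (m + 1) n, G fun i => l.residue i.castSucc := by
  have key : ∑ x : Weight (m + 1) n × Equiv.Perm (Fin m), G (fun i => x.1.residue i.castSucc) =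
      ∑ k, G k := by
    refine Finset.sum_of_injOn (fun x i => x.1.residue (x.2 i).castSucc) ?_
      (fun _ _ => Finset.mem_coe.mpr (Finset.mem_univ _)) ?_ ?_
    · rintro ⟨l, σ⟩ - ⟨k, τ⟩ - h
      have h' : ∀ i, bracket l.label (σ i).castSucc = bracket k.label (τ i).castSucc :=
        fun i => Weight.residue_eq_iff.mp (congrFun h i)
      have hl : StrictAnti fun i : Fin m => bracket l.label i.castSucc :=
        l.bracket_strictAnti.comp_strictMono Fin.strictMono_castSucc
      have hk : StrictAnti fun i : Fin m => bracket k.label i.castSucc :=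
        k.bracket_strictAnti.comp_strictMono Fin.strictMono_castSucc
      have hlk : (fun i : Fin m => bracket l.label i.castSucc) =
          fun i => bracket k.label i.castSucc := by
        refine (hl.range_inj hk).mp ?_
        exact (σ.surjective.range_comp fun i : Fin m => bracket l.label i.castSucc).symm.trans
          ((congrArg Set.range (funext h')).trans
            (τ.surjective.range_comp fun i : Fin m => bracket k.label i.castSucc))
      have e : l = k := by
        refine Weight.ext_bracket (funext fun i => ?_)
        refine Fin.lastCases ?_ (fun i => ?_) i
        · rw [bracket_last, bracket_last]
        · exact congrFun hlk i
      subst e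
      refine Prod.ext rfl (Equiv.ext fun i => ?_)
      exact Fin.castSucc_injective _ (l.bracket_strictAnti.injective (h' i))
    · intro k _ hk
      refine hzero k fun ⟨hinj, h0⟩ => hk ?_
      set f : Fin m → ℤ := fun i => -((k i).val : ℤ) with hf
      set σ := Tuple.sort f with hσ
      have hfinj : Function.Injective f := fun i j h => hinj (ZMod.val_injective n
        (by exact_mod_cast neg_injective h))
      have hmono : StrictMono (f ∘ σ) :=
        (Tuple.monotone_sort f).strictMono_of_injective (hfinj.comp σ.injective)
      set b : Fin (m + 1) → ℤ := Fin.snoc (α := fun _ => ℤ) (fun i => -f (σ i)) 0 with hb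
      have hpos : ∀ i, f i < 0 := fun i => by
        have := (ZMod.val_ne_zero (k i)).mpr (h0 i)
        simp only [hf]
        omega
      have hbanti : StrictAnti b := by
        intro i j hij
        revert hij
        refine Fin.lastCases (fun h => absurd h (not_lt.mpr (Fin.le_last j))) (fun i => ?_) i
        refine Fin.lastCases (fun _ => ?_) (fun j h => ?_) j
        · simpa [hb] using hpos _
        · have := hmono (Fin.castSucc_lt_castSucc_iff.mp h)
          simpa [hb] using this
      have hblt : b 0 < n := by
        have : ∀ i, b i < n := by
          intro i
          refine Fin.lastCases ?_ (fun i => ?_) i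
          · simpa [hb] using Nat.pos_of_ne_zero (NeZero.ne n)
          · have h1 : b i.castSucc = ((k (σ i)).val : ℤ) := by
              rw [hb, Fin.snoc_castSucc, hf, neg_neg]
            rw [h1]
            exact_mod_cast ZMod.val_lt (k (σ i))
        exact this 0
      refine ⟨(Weight.ofBracket b hbanti hblt (by simp [hb]), σ⁻¹), by simp, funext fun i => ?_⟩
      simp only [Weight.residue, Weight.bracket_ofBracket]
      simp [hb, hf]
    · rintro ⟨l, σ⟩ -
      exact (hperm σ fun i => l.residue i.castSucc).symm
  rw [← key, Fintype.sum_prod_type]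
  simp [Fintype.card_perm, Finset.mul_sum]

/-! ### Minors of the discrete Fourier transform -/

/-- The determinant `det (exp (-2πi a_i k_j / n))` for residues `a_i`, `k_j` modulo `n`. -/
noncomputable def fourierDet {N n : ℕ} [NeZero n] (a k : Fin N → ZMod n) : ℂ :=
  (Matrix.of fun i j : Fin N => ZMod.stdAddChar (-(a i * k j))).det

theorem fourierDet_perm {N n : ℕ} [NeZero n] (a k : Fin N → ZMod n) (σ : Equiv.Perm (Fin N)) :
    fourierDet a (k ∘ σ) = (Equiv.Perm.sign σ : ℤ) * fourierDet a k :=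
  Matrix.det_permute' σ (Matrix.of fun i j : Fin N => ZMod.stdAddChar (-(a i * k j)))

theorem fourierDet_eq_zero {N n : ℕ} [NeZero n] (a : Fin N → ZMod n) {k : Fin N → ZMod n}
    (hk : ¬ Function.Injective k) : fourierDet a k = 0 := by
  simp only [Function.Injective, not_forall] at hk
  obtain ⟨i, j, hij, hne⟩ := hk
  exact Matrix.det_zero_of_column_eq hne fun s => by simp [hij]

theorem addChar_sum {ι A R : Type*} [AddCommMonoid A] [CommMonoid R] (ψ : AddChar A R)
    (s : Finset ι) (f : ι → A) : ψ (∑ i ∈ s, f i) = ∏ i ∈ s, ψ (f i) := by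
  classical
  induction s using Finset.induction_on with
  | empty => simp
  | insert i s hi ih => rw [Finset.sum_insert hi, Finset.prod_insert hi, ψ.map_add_eq_mul, ih]

/-- Translating the first family of residues multiplies the determinant by a character of the sum
of the second one. -/
theorem fourierDet_sub_left {N n : ℕ} [NeZero n] (a k : Fin N → ZMod n) (c : ZMod n) :
    fourierDet (fun i => a i - c) k = ZMod.stdAddChar (c * ∑ j, k j) * fourierDet a k := by
  have h : (Matrix.of fun i j : Fin N => (ZMod.stdAddChar (-((a i - c) * k j)) : ℂ)) =
      Matrix.of fun i j => ZMod.stdAddChar (c * k j) *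
        (Matrix.of fun i j : Fin N => (ZMod.stdAddChar (-(a i * k j)) : ℂ)) i j := by
    ext i j
    simp only [Matrix.of_apply, ← AddChar.map_add_eq_mul]
    congr 1
    ring
  rw [fourierDet, h, Matrix.det_mul_row, fourierDet, Finset.mul_sum, addChar_sum]

theorem fourierDet_comm {N n : ℕ} [NeZero n] (a k : Fin N → ZMod n) :
    fourierDet a k = fourierDet k a := by
  unfold fourierDet
  rw [← Matrix.det_transpose]
  congr 1
  ext i j
  simp [mul_comm]

/-- Andréief's identity for the discrete Fourier transform. -/
theorem sum_fourierDet_mul_conj {N n : ℕ} [NeZero n] (a b : Fin N → ZMod n) :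
    ∑ k, fourierDet a k * (starRingEnd ℂ) (fourierDet b k) =
      ∑ σ : Equiv.Perm (Fin N), ∑ τ : Equiv.Perm (Fin N),
        ((Equiv.Perm.sign σ : ℤ) : ℂ) * ((Equiv.Perm.sign τ : ℤ) : ℂ) *
          if ∀ i, a (σ i) = b (τ i) then (n : ℂ) ^ N else 0 := by
  have h1 : ∀ k : Fin N → ZMod n, fourierDet a k * (starRingEnd ℂ) (fourierDet b k) =
      ∑ σ : Equiv.Perm (Fin N), ∑ τ : Equiv.Perm (Fin N),
        ((Equiv.Perm.sign σ : ℤ) : ℂ) * ((Equiv.Perm.sign τ : ℤ) : ℂ) *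
          ∏ i, ZMod.stdAddChar (k i * (b (τ i) - a (σ i))) := by
    intro k
    unfold fourierDet
    rw [Matrix.det_apply', Matrix.det_apply', map_sum, Finset.sum_mul_sum]
    refine Finset.sum_congr rfl fun σ _ => Finset.sum_congr rfl fun τ _ => ?_
    rw [map_mul, map_prod, map_intCast, mul_mul_mul_comm, ← Finset.prod_mul_distrib]
    congr 1
    refine Finset.prod_congr rfl fun i _ => ?_
    simp only [Matrix.of_apply]
    rw [← AddChar.map_neg_eq_conj, ← AddChar.map_add_eq_mul]
    congr 1
    ring
  simp only [h1]
  rw [Finset.sum_comm]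
  refine Finset.sum_congr rfl fun σ _ => ?_
  rw [Finset.sum_comm]
  refine Finset.sum_congr rfl fun τ _ => ?_
  rw [← Finset.mul_sum]
  congr 1
  have h2 := Finset.prod_univ_sum (fun _ : Fin N => (Finset.univ : Finset (ZMod n)))
    (fun i x => (ZMod.stdAddChar (x * (b (τ i) - a (σ i))) : ℂ))
  rw [Fintype.piFinset_univ] at h2
  rw [← h2]
  have h3 : ∀ i, ∑ x : ZMod n, (ZMod.stdAddChar (x * (b (τ i) - a (σ i))) : ℂ) =
      if a (σ i) = b (τ i) then (n : ℂ) else 0 := by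
    intro i
    rw [AddChar.sum_mulShift _ (ZMod.isPrimitive_stdAddChar n), ZMod.card]
    simp only [sub_eq_zero, eq_comm (a := b (τ i))]
    split_ifs <;> simp
  simp only [h3]
  split_ifs with h
  · simp [h]
  · push Not at h
    obtain ⟨i, hi⟩ := h
    exact Finset.prod_eq_zero (Finset.mem_univ i) (if_neg hi)

theorem sum_fourierDet_mul_conj_eq_zero {N n : ℕ} [NeZero n] {a b : Fin N → ZMod n}
    (h : ∀ σ : Equiv.Perm (Fin N), ¬ ∀ i, a (σ i) = b i) :
    ∑ k, fourierDet a k * (starRingEnd ℂ) (fourierDet b k) = 0 := by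
  rw [sum_fourierDet_mul_conj]
  refine Finset.sum_eq_zero fun σ _ => Finset.sum_eq_zero fun τ _ => ?_
  rw [if_neg, mul_zero]
  intro h'
  exact h (σ * τ⁻¹) fun i => by simpa using h' (τ⁻¹ i)

theorem sum_fourierDet_mul_conj_self {N n : ℕ} [NeZero n] {a : Fin N → ZMod n}
    (ha : Function.Injective a) :
    ∑ k, fourierDet a k * (starRingEnd ℂ) (fourierDet a k) = N.factorial * (n : ℂ) ^ N := by
  rw [sum_fourierDet_mul_conj]
  have h : ∀ σ τ : Equiv.Perm (Fin N), (∀ i, a (σ i) = a (τ i)) ↔ σ = τ := fun σ τ =>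
    ⟨fun h => Equiv.ext fun i => ha (h i), fun h i => by rw [h]⟩
  simp only [h, mul_ite, mul_zero, Finset.sum_ite_eq, Finset.mem_univ, if_true]
  have hs : ∀ σ : Equiv.Perm (Fin N),
      ((Equiv.Perm.sign σ : ℤ) : ℂ) * ((Equiv.Perm.sign σ : ℤ) : ℂ) = 1 := by
    intro σ
    rw [← Int.cast_mul, ← Units.val_mul, Int.units_mul_self]
    simp
  simp [hs, Fintype.card_perm]

/-- A sum over all tuples of residues of a symmetric, translation-invariant function that
vanishes off the injective tuples is a multiple of a sum over weights. -/
theorem sum_eq_sum_weight {m n : ℕ} [NeZero n] (H : (Fin (m + 1) → ZMod n) → ℂ)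
    (hperm : ∀ (σ : Equiv.Perm (Fin (m + 1))) k, H (k ∘ σ) = H k)
    (hzero : ∀ k, ¬ Function.Injective k → H k = 0)
    (hshift : ∀ k c, H (fun i => k i - c) = H k) :
    ∑ k, H k = n * (m.factorial * ∑ l : Weight (m + 1) n, H l.residue) := by
  rw [← Equiv.sum_comp (Fin.snocEquiv fun _ => ZMod n), Fintype.sum_prod_type]
  have h1 : ∀ c : ZMod n, ∑ k : Fin m → ZMod n, H (Fin.snocEquiv (fun _ => ZMod n) (c, k)) =
      ∑ k : Fin m → ZMod n, H (Fin.snoc (α := fun _ => ZMod n) k 0) := by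
    intro c
    rw [← Equiv.sum_comp (Equiv.addRight (fun _ : Fin m => c))]
    refine Finset.sum_congr rfl fun k _ => ?_
    rw [← hshift _ c]
    congr 1
    funext i
    refine Fin.lastCases ?_ (fun i => ?_) i <;> simp [Fin.snocEquiv]
  simp only [h1]
  rw [Finset.sum_const, Finset.card_univ, ZMod.card, nsmul_eq_mul]
  congr 1
  rw [sum_tuple_eq_sum_weight (fun k => H (Fin.snoc (α := fun _ => ZMod n) k 0))]
  · congr 1
    refine Finset.sum_congr rfl fun l _ => ?_
    congr 1
    funext i
    refine Fin.lastCases ?_ (fun i => ?_) i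
    · simp [l.residue_last]
    · simp
  · intro σ k
    rw [← hperm (finSuccEquivLast.symm.permCongr (Equiv.optionCongr σ)) (Fin.snoc k 0)]
    congr 1
    funext i
    refine Fin.lastCases ?_ (fun i => ?_) i <;> simp [Equiv.permCongr_apply]
  · intro k hk
    refine hzero _ fun hinj => hk ⟨fun i j h => ?_, fun i h => ?_⟩
    · have := @hinj i.castSucc j.castSucc (by simpa using h)
      exact Fin.castSucc_injective _ this
    · have := @hinj i.castSucc (Fin.last m) (by simpa using h)
      exact absurd this (Fin.castSucc_lt_last i).ne

/-! ### Orthogonality of the `SU(N)` matrix `S` -/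

theorem suS_eq_fourierDet {m n : ℕ} [NeZero n] (l k : Weight (m + 1) n) :
    suS (n : ℚ) l.label k.label =
      exp (2 * Real.pi * I * ((nality l.label * nality k.label : ℤ) : ℂ) /
        (((m + 1 : ℕ) : ℂ) * (n : ℂ))) * fourierDet l.residue k.residue := by
  unfold suS fourierDet
  rw [Rat.cast_natCast]
  congr 2
  ext i j
  simp only [Matrix.of_apply, Weight.residue]
  rw [← Int.cast_mul, ← Int.cast_neg, ZMod.stdAddChar_coe]
  congr 1
  push_cast
  ring

theorem sum_residue {m n : ℕ} (l : Weight (m + 1) n) :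
    ∑ i, l.residue i = (nality l.label : ZMod n) := by
  rw [nality_eq_sum_bracket]
  push_cast
  rfl

/-- Two weights whose partial sums agree modulo the height up to a rearrangement and a translation
that accounts exactly for the difference of the `N`-alities are equal. -/
theorem Weight.eq_of_residue_sub {m n : ℕ} [NeZero n] {l k : Weight (m + 1) n} {c : ℤ}
    (hc : nality l.label - nality k.label = ((m + 1 : ℕ) : ℤ) * c) {σ : Equiv.Perm (Fin (m + 1))}
    (h : ∀ i, l.residue (σ i) - c = k.residue i) : l = k := by
  have hn : (0 : ℤ) < n := by exact_mod_cast Nat.pos_of_ne_zero (NeZero.ne n)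
  have h1 : ∀ i, ∃ d : ℤ, bracket l.label (σ i) - c - bracket k.label i = n * d := by
    intro i
    have := h i
    rw [Weight.residue, Weight.residue, ← Int.cast_sub,
      ZMod.intCast_eq_intCast_iff_dvd_sub] at this
    obtain ⟨d, hd⟩ := this
    exact ⟨-d, by linarith⟩
  choose d hd using h1
  have hsum : ∑ i, d i = 0 := by
    have h2 : ∑ i, (bracket l.label (σ i) - c - bracket k.label i) = n * ∑ i, d i := by
      rw [Finset.mul_sum]
      exact Finset.sum_congr rfl fun i _ => hd i
    rw [Finset.sum_sub_distrib, Finset.sum_sub_distrib, Equiv.sum_comp σ (bracket l.label),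
      ← nality_eq_sum_bracket, ← nality_eq_sum_bracket] at h2
    simp only [Finset.sum_const, Finset.card_univ, Fintype.card_fin, nsmul_eq_mul] at h2
    have h3 : (n : ℤ) * ∑ i, d i = 0 := by linarith
    exact (mul_eq_zero.mp h3).resolve_left hn.ne'
  -- the integers `d i` lie in an open interval of length two and add up to zero
  have hdd : ∀ i j, d i - d j < 2 := by
    intro i j
    have h2 := l.bracket_lt (σ i)
    have h3 := l.bracket_nonneg (σ j)
    have h4 := k.bracket_lt j
    have h5 := k.bracket_nonneg i
    have h6 : (n : ℤ) * (d i - d j) < n * 2 := by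
      rw [mul_sub, ← hd, ← hd]
      linarith
    exact lt_of_mul_lt_mul_left h6 hn.le
  have hd0 : ∀ i, d i = 0 := by
    by_contra hne
    have hne' : ∃ i ∈ Finset.univ, d i ≠ 0 := by
      push Not at hne
      exact hne.imp fun i hi => ⟨Finset.mem_univ i, hi⟩
    obtain ⟨i, -, hi⟩ := Finset.exists_pos_of_sum_zero_of_exists_nonzero d hsum hne'
    have hneg : ∑ i, -d i = 0 := by simp [hsum]
    obtain ⟨j, -, hj⟩ := Finset.exists_pos_of_sum_zero_of_exists_nonzero (fun i => -d i) hneg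
      (hne'.imp fun i hi => ⟨hi.1, neg_ne_zero.mpr hi.2⟩)
    have := hdd i j
    omega
  have hb : ∀ i, bracket l.label (σ i) = bracket k.label i + c := by
    intro i
    have := hd i
    rw [hd0, mul_zero] at this
    linarith
  have hc0 : c = 0 := by
    have h2 := hb (Fin.last m)
    have h3 := hb (σ.symm (Fin.last m))
    rw [bracket_last, zero_add] at h2
    rw [Equiv.apply_symm_apply, bracket_last] at h3
    have h4 := l.bracket_nonneg (σ (Fin.last m))
    have h5 := k.bracket_nonneg (σ.symm (Fin.last m))
    omega
  exact Weight.ext_range (σ := σ) fun i => by rw [hb, hc0, add_zero]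

theorem conj_exp_two_pi_I_int_div (a : ℤ) (b : ℕ) :
    (starRingEnd ℂ) (exp (2 * Real.pi * I * (a : ℂ) / (b : ℂ))) =
      exp (-(2 * Real.pi * I * (a : ℂ) / (b : ℂ))) := by
  rw [← exp_conj]
  congr 1
  simp only [map_div₀, map_mul, conj_ofReal, conj_I, map_intCast, map_natCast, map_ofNat]
  ring

/-- Up to a constant, the `SU(N)` matrix `S` at an integral height is unitary. -/
theorem sum_suS_mul_conj {m n : ℕ} (hn : n ≠ 0) (l l' : Weight (m + 1) n) :
    ∑ k : Weight (m + 1) n, suS (n : ℚ) l.label k.label *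
        (starRingEnd ℂ) (suS (n : ℚ) l'.label k.label) =
      if l = l' then ((m + 1 : ℕ) : ℂ) * (n : ℂ) ^ m else 0 := by
  have : NeZero n := ⟨hn⟩
  have hm : ((m + 1 : ℕ) : ℂ) ≠ 0 := by exact_mod_cast Nat.succ_ne_zero m
  have hnC : (n : ℂ) ≠ 0 := by exact_mod_cast hn
  by_cases ht : ((m + 1 : ℕ) : ℤ) ∣ nality l.label - nality l'.label
  -- the phases combine to a translation of the residues of `l` by `c`; the summand then extends to
  -- a symmetric, translation-invariant function of all tuples of residues
  · obtain ⟨c, hc⟩ := ht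
    set a : Fin (m + 1) → ZMod n := fun i => l.residue i - (c : ZMod n) with ha
    set H : (Fin (m + 1) → ZMod n) → ℂ := fun k =>
      fourierDet a k * (starRingEnd ℂ) (fourierDet l'.residue k) with hH
    have hterm : ∀ k : Weight (m + 1) n, suS (n : ℚ) l.label k.label *
        (starRingEnd ℂ) (suS (n : ℚ) l'.label k.label) = H k.residue := by
      intro k
      have e1 : exp (2 * Real.pi * I * ((nality l.label * nality k.label : ℤ) : ℂ) /
            (((m + 1 : ℕ) : ℂ) * (n : ℂ))) *
          (starRingEnd ℂ) (exp (2 * Real.pi * I * ((nality l'.label * nality k.label : ℤ) : ℂ) /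
            (((m + 1 : ℕ) : ℂ) * (n : ℂ)))) =
          ZMod.stdAddChar ((c : ZMod n) * ∑ j, k.residue j) := by
        rw [sum_residue, ← Int.cast_mul, ZMod.stdAddChar_coe, ← Nat.cast_mul,
          conj_exp_two_pi_I_int_div, ← exp_add]
        congr 1
        have hc' : (nality l.label : ℂ) - nality l'.label = ((m + 1 : ℕ) : ℂ) * c := by
          exact_mod_cast hc
        rw [Nat.cast_mul]
        push_cast at hm hc' ⊢
        field_simp
        linear_combination (nality k.label : ℂ) * hc'
      rw [suS_eq_fourierDet, suS_eq_fourierDet, hH]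
      simp only
      rw [ha, fourierDet_sub_left, ← e1, map_mul]
      ring
    have hsum := sum_eq_sum_weight H (fun σ k => by
        have hs : ((Equiv.Perm.sign σ : ℤ) : ℂ) * ((Equiv.Perm.sign σ : ℤ) : ℂ) = 1 := by
          rw [← Int.cast_mul, ← Units.val_mul, Int.units_mul_self]
          simp
        simp only [hH, fourierDet_perm, map_mul, map_intCast]
        linear_combination (fourierDet a k * (starRingEnd ℂ) (fourierDet l'.residue k)) * hs)
      (fun k hk => by simp only [hH, fourierDet_eq_zero a hk, zero_mul])
      (fun k d => by
        have hsums : ∑ i, a i = ∑ i, l'.residue i := by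
          rw [ha, Finset.sum_sub_distrib, sum_residue, sum_residue]
          have hc' : (nality l.label : ZMod n) - nality l'.label = ((m + 1 : ℕ) : ZMod n) * c := by
            exact_mod_cast congrArg (Int.cast : ℤ → ZMod n) hc
          simp only [Finset.sum_const, Finset.card_univ, Fintype.card_fin, nsmul_eq_mul]
          linear_combination hc'
        simp only [hH]
        rw [fourierDet_comm a, fourierDet_sub_left, fourierDet_comm l'.residue,
          fourierDet_sub_left, map_mul (starRingEnd ℂ),
          ← AddChar.map_neg_eq_conj, hsums, fourierDet_comm k a,
          fourierDet_comm k]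
        have h1 : (ZMod.stdAddChar (d * ∑ i, l'.residue i) : ℂ) *
            ZMod.stdAddChar (-(d * ∑ i, l'.residue i)) = 1 := by
          rw [← AddChar.map_add_eq_mul, add_neg_cancel, AddChar.map_zero_eq_one]
        linear_combination (fourierDet a k * (starRingEnd ℂ) (fourierDet l'.residue k)) * h1)
    simp only [hterm]
    have hfac : (n : ℂ) * (m.factorial : ℂ) ≠ 0 :=
      mul_ne_zero hnC (by exact_mod_cast m.factorial_ne_zero)
    refine mul_left_cancel₀ hfac ?_
    rw [mul_assoc, ← hsum]
    split_ifs with hl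
    · subst hl
      have hc0 : c = 0 := by
        rw [sub_self] at hc
        exact (mul_eq_zero.mp hc.symm).resolve_left (by exact_mod_cast Nat.succ_ne_zero m)
      have ha' : a = l.residue := by
        funext i
        simp [ha, hc0]
      rw [hH, ha', sum_fourierDet_mul_conj_self l.residue_injective, Nat.factorial_succ]
      push_cast
      ring
    · rw [mul_zero]
      exact sum_fourierDet_mul_conj_eq_zero fun σ hσ => hl (Weight.eq_of_residue_sub hc hσ)
  -- otherwise the rotation `J` of the summation variable multiplies the sum by a phase other than one
  · have hl : l ≠ l' := fun h => ht (by rw [h, sub_self]; exact dvd_zero _)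
    rw [if_neg hl]
    set f : Weight (m + 1) n → ℂ := fun k => suS (n : ℚ) l.label k.label *
        (starRingEnd ℂ) (suS (n : ℚ) l'.label k.label) with hf
    set z : ℂ := exp (2 * Real.pi * I * ((nality l.label - nality l'.label : ℤ) : ℂ) /
      ((m + 1 : ℕ) : ℂ)) with hz
    have hJ : ∀ k, f (J (m + 1) n k) = z * f k := by
      intro k
      have hnQ : (n : ℚ) ≠ 0 := by exact_mod_cast hn
      simp only [hf]
      rw [suS_comm _ l.label, suS_comm _ l'.label, suS_J (n : ℚ) 1 hnQ (by simp),
        suS_J (n : ℚ) 1 hnQ (by simp), map_mul, map_mul, conj_exp_two_pi_I_int_div,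
        suS_comm _ k.label, suS_comm _ k.label]
      have h1 : ((-1 : ℂ) ^ m) * (starRingEnd ℂ) ((-1) ^ m) = 1 := by
        rw [map_pow, map_neg, map_one, ← mul_pow]
        simp
      have h2 : z = exp (2 * Real.pi * I * ((1 * nality l.label : ℤ) : ℂ) / ((m + 1 : ℕ) : ℂ)) *
          exp (-(2 * Real.pi * I * ((1 * nality l'.label : ℤ) : ℂ) / ((m + 1 : ℕ) : ℂ))) := by
        rw [hz, ← exp_add]
        congr 1
        push_cast
        ring
      rw [h2]
      generalize exp (2 * Real.pi * I * ((1 * nality l.label : ℤ) : ℂ) / ((m + 1 : ℕ) : ℂ)) = e1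
      generalize exp (-(2 * Real.pi * I * ((1 * nality l'.label : ℤ) : ℂ) /
        ((m + 1 : ℕ) : ℂ))) = e2
      linear_combination (e1 * e2 * suS (n : ℚ) l.label k.label *
        (starRingEnd ℂ) (suS (n : ℚ) l'.label k.label)) * h1
    have hsum : ∑ k, f k = z * ∑ k, f k := by
      rw [Finset.mul_sum, ← Equiv.sum_comp (J (m + 1) n)]
      exact Finset.sum_congr rfl fun k _ => hJ k
    have hz1 : z ≠ 1 := by
      intro h
      rw [hz, exp_eq_one_iff] at h
      obtain ⟨d, hd⟩ := h
      refine ht ⟨d, ?_⟩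
      have h2 : (2 * Real.pi * I : ℂ) ≠ 0 := two_pi_I_ne_zero
      rw [div_eq_iff hm] at hd
      have h3 : ((nality l.label - nality l'.label : ℤ) : ℂ) = ((m + 1 : ℕ) : ℂ) * d :=
        mul_left_cancel₀ h2 (by linear_combination hd)
      exact_mod_cast h3
    have : (z - 1) * ∑ k, f k = 0 := by linear_combination -hsum
    exact (mul_eq_zero.mp this).resolve_left (sub_ne_zero.mpr hz1)

/-! ### The vacuum row of the matrix `S` -/

theorem bracket_rho {m n : ℕ} (hN : 2 ≤ m + 1) (hn : m + 1 < n) (i : Fin (m + 1)) :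
    bracket (rho hN hn).label i = m - i.val := by
  induction i using Fin.reverseInduction with
  | last => rw [bracket_last]; simp
  | cast i ih =>
    rw [bracket_castSucc, ih]
    simp [rho]
    ring

theorem two_mul_nality_rho {m n : ℕ} (hN : 2 ≤ m + 1) (hn : m + 1 < n) :
    2 * nality (rho hN hn).label = ((m + 1 : ℕ) : ℤ) * m := by
  have h : ∑ i : Fin (m + 1), (i.val : ℤ) = ∑ i ∈ Finset.range (m + 1), (i : ℤ) :=
    Fin.sum_univ_eq_sum_range (fun i => (i : ℤ)) (m + 1)
  have h2 := Finset.sum_range_id_mul_two (m + 1)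
  have h3 : (∑ i ∈ Finset.range (m + 1), (i : ℤ)) * 2 = ((m + 1 : ℕ) : ℤ) * m := by
    rw [Nat.add_sub_cancel] at h2
    rw [← Nat.cast_mul, ← h2]
    push_cast
    rfl
  rw [nality_eq_sum_bracket]
  simp only [bracket_rho, Finset.sum_sub_distrib, h]
  simp only [Finset.sum_const, Finset.card_univ, Fintype.card_fin, nsmul_eq_mul]
  push_cast at h3 ⊢
  linarith

theorem exp_sub_exp_eq_sin (x y : ℂ) :
    exp (-(2 * y * I)) - exp (-(2 * x * I)) = exp (-((x + y) * I)) * (2 * I * sin (x - y)) := by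
  have h : exp (-((x + y) * I)) * (2 * I * sin (x - y)) =
      exp (-((x + y) * I)) * (exp ((x - y) * I) - exp (-(x - y) * I)) := by
    rw [sin]
    congr 1
    linear_combination (-(exp (-(x - y) * I) - exp ((x - y) * I))) * (-I_mul_I)
  rw [h, mul_sub, ← exp_add, ← exp_add]
  congr 2 <;> ring

/-- By the Weyl denominator formula, the entries of the vacuum row of `S` are, up to a common
factor, products of positive sines. -/
theorem exists_suS_rho {m n : ℕ} (hN : 2 ≤ m + 1) (hn : m + 1 < n) :
    ∃ c : ℂ, c ≠ 0 ∧ ∀ k : Weight (m + 1) n, ∃ s : ℝ, 0 < s ∧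
      suS (n : ℚ) (rho hN hn).label k.label = c * s := by
  have hn0 : (n : ℂ) ≠ 0 := by
    have : n ≠ 0 := by omega
    exact_mod_cast this
  have hn1 : (0 : ℝ) < n := by
    have : 0 < n := by omega
    exact_mod_cast this
  have hm : ((m + 1 : ℕ) : ℂ) ≠ 0 := by exact_mod_cast Nat.succ_ne_zero m
  refine ⟨((Equiv.Perm.sign (Fin.revPerm : Equiv.Perm (Fin (m + 1))) : ℤ) : ℂ) *
    ∏ i : Fin (m + 1), ∏ j ∈ Finset.Ioi i, (2 * I), ?_, fun k =>
      ⟨∏ i : Fin (m + 1), ∏ j ∈ Finset.Ioi i,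
        Real.sin (Real.pi * (bracket k.label i - bracket k.label j : ℤ) / n), ?_, ?_⟩⟩
  · refine mul_ne_zero (by simp) ?_
    exact Finset.prod_ne_zero_iff.mpr fun i _ => Finset.prod_ne_zero_iff.mpr fun j _ =>
      mul_ne_zero two_ne_zero I_ne_zero
  · refine Finset.prod_pos fun i _ => Finset.prod_pos fun j hj => ?_
    have h1 := k.bracket_strictAnti (Finset.mem_Ioi.mp hj)
    have h2 := k.bracket_lt i
    have h3 := k.bracket_nonneg j
    have h4 : (0 : ℝ) < (bracket k.label i - bracket k.label j : ℤ) := by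
      exact_mod_cast sub_pos.mpr h1
    have h5 : ((bracket k.label i - bracket k.label j : ℤ) : ℝ) < n := by
      exact_mod_cast (by omega : bracket k.label i - bracket k.label j < n)
    refine Real.sin_pos_of_pos_of_lt_pi (by positivity) ?_
    rw [div_lt_iff₀ hn1]
    exact mul_lt_mul_of_pos_left h5 Real.pi_pos
  · set b := bracket k.label with hb
    set x : Fin (m + 1) → ℂ := fun j => exp (-(2 * (Real.pi * (b j : ℂ) / n) * I)) with hx
    have hdet : (Matrix.of fun i j : Fin (m + 1) =>
        exp (-(2 * Real.pi * I * ((bracket (rho hN hn).label i * b j : ℤ) : ℂ) /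
          ((n : ℚ) : ℂ)))).det =
        ((Equiv.Perm.sign (Fin.revPerm : Equiv.Perm (Fin (m + 1))) : ℤ) : ℂ) *
          ∏ i : Fin (m + 1), ∏ j ∈ Finset.Ioi i, (x j - x i) := by
      rw [← Matrix.det_vandermonde, ← Matrix.det_transpose (Matrix.vandermonde x),
        ← Matrix.det_permute]
      congr 1
      ext i j
      have hi : ((Fin.revPerm i : Fin (m + 1)).val : ℂ) = m - i.val := by
        have h1 : (Fin.revPerm i : Fin (m + 1)).val = m - i.val := by
          simp [Fin.val_rev]
        have h2 : i.val ≤ m := by omega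
        rw [h1]
        push_cast [h2]
        ring
      simp only [Matrix.of_apply, Matrix.submatrix_apply, id, Matrix.transpose_apply,
        Matrix.vandermonde_apply, hx]
      rw [← exp_nat_mul, hi, bracket_rho]
      congr 1
      push_cast
      ring
    have hsum : ∑ i : Fin (m + 1), ∑ j ∈ Finset.Ioi i, (b i + b j) = m * nality k.label := by
      have h1 := sum_sum_eq_diag_add (fun i _ : Fin (m + 1) => (b i : ℚ))
      have h2 : ∀ i : Fin (m + 1), ∑ j ∈ Finset.Ioi i, ((b i : ℚ) + b j) =
          ∑ j, if i < j then (b i : ℚ) + b j else 0 := by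
        intro i
        rw [← Finset.sum_filter]
        refine Finset.sum_congr ?_ fun _ _ => rfl
        ext; simp
      have h3 : (∑ i : Fin (m + 1), ∑ j ∈ Finset.Ioi i, ((b i : ℚ) + b j)) =
          m * ∑ i, (b i : ℚ) := by
        simp only [h2]
        simp only [Finset.sum_const, Finset.card_univ, Fintype.card_fin, nsmul_eq_mul,
          ← Finset.mul_sum] at h1
        push_cast at h1
        linarith
      rw [nality_eq_sum_bracket]
      exact_mod_cast h3
    have hprod : ∏ i : Fin (m + 1), ∏ j ∈ Finset.Ioi i, (x j - x i) =
        exp (-(Real.pi * (m * nality k.label : ℤ) / n * I)) *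
          ((∏ i : Fin (m + 1), ∏ j ∈ Finset.Ioi i, (2 * I)) *
          ∏ i : Fin (m + 1), ∏ j ∈ Finset.Ioi i,
            ((Real.sin (Real.pi * (b i - b j : ℤ) / n) : ℝ) : ℂ)) := by
      have h1 : ∀ i j, x j - x i = exp (-(Real.pi * (b i + b j : ℤ) / n * I)) *
          ((2 * I) * ((Real.sin (Real.pi * (b i - b j : ℤ) / n) : ℝ) : ℂ)) := by
        intro i j
        rw [hx]
        simp only
        rw [exp_sub_exp_eq_sin]
        push_cast
        congr 2
        · ring_nf
        · congr 1
          ring_nf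
      simp only [h1, Finset.prod_mul_distrib]
      congr 1
      simp only [← exp_sum]
      rw [← hsum]
      congr 1
      push_cast
      simp only [Finset.sum_neg_distrib, Finset.sum_mul, Finset.sum_div, Finset.mul_sum]
    unfold suS
    rw [← hb, hdet, hprod]
    have hphase : exp (2 * Real.pi * I * ((nality (rho hN hn).label * nality k.label : ℤ) : ℂ) /
          (((m + 1 : ℕ) : ℂ) * ((n : ℚ) : ℂ))) *
        exp (-(Real.pi * (m * nality k.label : ℤ) / n * I)) = 1 := by
      rw [← exp_add, ← exp_zero]
      congr 1
      have h2 : (2 * nality (rho hN hn).label : ℂ) = ((m + 1 : ℕ) : ℂ) * m := by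
        exact_mod_cast two_mul_nality_rho hN hn
      push_cast at hm h2 ⊢
      field_simp
      linear_combination (Real.pi * I * nality k.label : ℂ) * h2
    push_cast at hphase ⊢
    linear_combination (((Equiv.Perm.sign (Fin.revPerm : Equiv.Perm (Fin (m + 1))) : ℤ) : ℂ) *
      ((∏ i : Fin (m + 1), ∏ j ∈ Finset.Ioi i, (2 * I)) *
          ∏ i : Fin (m + 1), ∏ j ∈ Finset.Ioi i,
            (sin (Real.pi * (b i - b j) / n)))) * hphase

/-! ### Simple currents and modular invariants -/

section SimpleCurrent

variable {Φ : Type*} [Fintype Φ] [DecidableEq Φ] {S M : Matrix Φ Φ ℂ} {C : ℂ}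

/-- If the charge `θ` of a simple current `j` is respected by a matrix `M` commuting with `S`, then
`M` is invariant under `j`: the matrix `S` intertwines multiplication by `θ` with the action of
`j`. -/
theorem apply_simpleCurrent_eq (hC : C ≠ 0) (hS : S * S.conjTranspose = C • 1)
    (hM : S * M = M * S) {j : Equiv.Perm Φ} {θ : Φ → ℂ} (hθ0 : ∀ y, θ y ≠ 0)
    (hj : ∀ x y, S (j x) y = θ y * S x y) (hθ : ∀ x y, M x y ≠ 0 → θ x = θ y) (x y : Φ) :
    M (j x) (j y) = M x y := by
  have h1 : ∀ a b, (S * M) (j a) b = θ b * (S * M) a b := by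
    intro a b
    rw [Matrix.mul_apply, Matrix.mul_apply, Finset.mul_sum]
    refine Finset.sum_congr rfl fun z _ => ?_
    by_cases h : M z b = 0
    · simp [h]
    · rw [hj, hθ z b h]
      ring
  have h2 : M.submatrix j j * S = M * S := by
    ext a b
    refine mul_left_cancel₀ (hθ0 b) ?_
    rw [← hM, ← h1, hM, Matrix.mul_apply, Matrix.mul_apply, Finset.mul_sum,
      ← Equiv.sum_comp j fun z => M (j a) z * S z b]
    refine Finset.sum_congr rfl fun z _ => ?_
    rw [hj, Matrix.submatrix_apply]
    ring
  have h3 : C • M.submatrix j j = C • M := by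
    have h4 := congrArg (· * S.conjTranspose) h2
    simpa [Matrix.mul_assoc, hS] using h4
  exact congrFun (congrFun (smul_right_injective _ hC h3) x) y

/-- If the row of the vacuum is positive up to a common factor, and the diagonal entries of `M` at
the vacuum and at its image under the simple current `j` are both one, then `M` respects the
charge of `j`. Both entries are sums over the nonzero entries of `M`, with weights that are
positive for the first and differ from them by phases for the second, so all phases are trivial. -/
theorem simpleCurrent_charge_eq (hC : C ≠ 0) (hS : S * S.conjTranspose = C • 1)
    (hsymm : S.transpose = S) (hM : S * M = M * S) (hnat : ∀ x y, ∃ m : ℕ, M x y = m)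
    {j : Equiv.Perm Φ} {θ : Φ → ℂ} (hθ1 : ∀ y, ‖θ y‖ = 1)
    (hj : ∀ x y, S (j x) y = θ y * S x y) {v : Φ} {c : ℂ} (hc : c ≠ 0) {s : Φ → ℝ}
    (hs : ∀ y, 0 < s y) (hv : ∀ y, S v y = c * s y) (hMv : M v v = 1)
    (hMj : M (j v) (j v) = 1) {x y : Φ} (hxy : M x y ≠ 0) : θ x = θ y := by
  have hS' : S.conjTranspose * S = C • 1 := by
    have h1 : S * (C⁻¹ • S.conjTranspose) = 1 := by
      rw [Matrix.mul_smul, hS, smul_smul, inv_mul_cancel₀ hC, one_smul]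
    have h2 := mul_eq_one_comm.mp h1
    rw [Matrix.smul_mul] at h2
    rw [← h2, smul_smul, mul_inv_cancel₀ hC, one_smul]
  have hCM : C • M = S.conjTranspose * (M * S) := by
    rw [← hM, ← Matrix.mul_assoc, hS', Matrix.smul_mul, Matrix.one_mul]
  have hdiag : ∀ w, C * M w w =
      ∑ a, ∑ b, (starRingEnd ℂ) (S w a) * M a b * S w b := by
    intro w
    have h1 := congrFun (congrFun hCM w) w
    rw [Matrix.smul_apply, smul_eq_mul, Matrix.mul_apply] at h1
    rw [h1]
    refine Finset.sum_congr rfl fun a _ => ?_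
    rw [Matrix.mul_apply, Finset.mul_sum]
    refine Finset.sum_congr rfl fun b _ => ?_
    have e : ∀ a b, S a b = S b a := fun a b => congrFun (congrFun hsymm b) a
    rw [Matrix.conjTranspose_apply, e a w, e w b, mul_assoc]
    rfl
  choose μ hμ using hnat
  have hsum : ∑ a, ∑ b, (s a * s b * μ a b : ℝ) *
      (1 - ((starRingEnd ℂ) (θ a) * θ b).re) = 0 := by
    have h1 := hdiag v
    have h2 := hdiag (j v)
    rw [hMv] at h1
    rw [hMj] at h2
    have h3 : (c * (starRingEnd ℂ) c) * ∑ a, ∑ b, ((s a * s b * μ a b : ℝ) : ℂ) *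
        (1 - (starRingEnd ℂ) (θ a) * θ b) = 0 := by
      rw [← sub_eq_zero.mpr (h1.symm.trans h2), ← Finset.sum_sub_distrib, Finset.mul_sum]
      refine Finset.sum_congr rfl fun a _ => ?_
      rw [← Finset.sum_sub_distrib, Finset.mul_sum]
      refine Finset.sum_congr rfl fun b _ => ?_
      rw [hj, hj, hv, hv, hμ]
      simp only [map_mul, conj_ofReal]
      push_cast
      ring
    have h4 : c * (starRingEnd ℂ) c ≠ 0 :=
      mul_ne_zero hc ((map_ne_zero (starRingEnd ℂ)).mpr hc)
    have h5 := congrArg Complex.re ((mul_eq_zero.mp h3).resolve_left h4)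
    simpa only [re_sum, re_ofReal_mul, sub_re, one_re, zero_re] using h5
  have hnorm : ∀ a b, ‖(starRingEnd ℂ) (θ a) * θ b‖ = 1 := fun a b => by
    rw [norm_mul, norm_conj, hθ1, hθ1, one_mul]
  have hre : ∀ a b, ((starRingEnd ℂ) (θ a) * θ b).re ≤ 1 := fun a b =>
    (re_le_norm _).trans_eq (hnorm a b)
  have hterm : ∀ a b, 0 ≤ (s a * s b * μ a b : ℝ) *
      (1 - ((starRingEnd ℂ) (θ a) * θ b).re) := fun a b =>
    mul_nonneg (mul_nonneg (mul_pos (hs a) (hs b)).le (Nat.cast_nonneg _))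
      (sub_nonneg.mpr (hre a b))
  have h6 := (Finset.sum_eq_zero_iff_of_nonneg fun a _ =>
    Finset.sum_nonneg fun b _ => hterm a b).mp hsum x (Finset.mem_univ x)
  have h7 := (Finset.sum_eq_zero_iff_of_nonneg fun b _ => hterm x b).mp h6 y (Finset.mem_univ y)
  have hμ0 : (μ x y : ℝ) ≠ 0 := by
    rw [hμ] at hxy
    exact_mod_cast hxy
  have h8 : ((starRingEnd ℂ) (θ x) * θ y).re = 1 := by
    have := (mul_eq_zero.mp h7).resolve_left
      (mul_ne_zero (mul_pos (hs x) (hs y)).ne' hμ0)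
    linarith
  have h9 : (starRingEnd ℂ) (θ x) * θ y = 1 := by
    have h10 : ((starRingEnd ℂ) (θ x) * θ y).im = 0 := by
      have h11 := Complex.sq_norm ((starRingEnd ℂ) (θ x) * θ y)
      rw [hnorm, normSq_apply, h8] at h11
      exact mul_self_eq_zero.mp (by linarith)
    exact Complex.ext h8 h10
  have h12 : θ x * (starRingEnd ℂ) (θ x) = 1 := by
    rw [mul_conj, normSq_eq_norm_sq, hθ1]
    simp
  calc θ x = θ x * ((starRingEnd ℂ) (θ x) * θ y) := by rw [h9, mul_one]
    _ = θ y := by rw [← mul_assoc, h12, one_mul]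

end SimpleCurrent

/-! ### Powers of the simple currents -/

theorem apply_zpow_add {α G : Type*} [AddCommGroup G] {σ : Equiv.Perm α} {f : α → G} {d : G}
    (h : ∀ x, f (σ x) = f x + d) (i : ℤ) (x : α) : f ((σ ^ i) x) = f x + i • d := by
  induction i using Int.induction_on with
  | zero => simp
  | succ i ih =>
    rw [add_comm, zpow_add, zpow_one, Equiv.Perm.mul_apply, h, ih, add_zsmul, one_zsmul]
    abel
  | pred i ih =>
    have h1 := h ((σ ^ (-(i : ℤ) - 1)) x)
    rw [← Equiv.Perm.mul_apply, ← zpow_one_add, add_sub_cancel, ih] at h1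
    rw [eq_sub_of_add_eq h1.symm, sub_zsmul, one_zsmul]
    abel

theorem apply_zpow_mul {α K : Type*} [Field K] {σ : Equiv.Perm α} {f : α → K} {c : K}
    (hc : c ≠ 0) (h : ∀ x, f (σ x) = c * f x) (i : ℤ) (x : α) :
    f ((σ ^ i) x) = c ^ i * f x := by
  induction i using Int.induction_on with
  | zero => simp
  | succ i ih =>
    rw [add_comm, zpow_add, zpow_one, Equiv.Perm.mul_apply, h, ih, zpow_add₀ hc, zpow_one,
      mul_assoc]
  | pred i ih =>
    have h1 := h ((σ ^ (-(i : ℤ) - 1)) x)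
    rw [← Equiv.Perm.mul_apply, ← zpow_one_add, add_sub_cancel, ih] at h1
    refine mul_left_cancel₀ hc ?_
    rw [← h1, zpow_sub₀ hc, zpow_one]
    field_simp

theorem val_finRotate_pow {m : ℕ} (k : ℕ) (i : Fin (m + 1)) :
    (((finRotate (m + 1)) ^ k) i).val = (i.val + k) % (m + 1) := by
  induction k with
  | zero => simp [Nat.mod_eq_of_lt i.isLt]
  | succ k ih =>
    rw [pow_succ', Equiv.Perm.mul_apply, finRotate_apply, Fin.val_add, ih, Fin.val_one',
      ← Nat.add_mod, add_assoc]

theorem J_pow_label {m n : ℕ} (k : ℕ) (l : Weight (m + 1) n) (i : Fin (m + 1)) :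
    ((J (m + 1) n ^ k) l).label i = l.label ((((finRotate (m + 1)).symm) ^ k) i) := by
  induction k generalizing l with
  | zero => simp
  | succ k ih =>
    rw [pow_succ, Equiv.Perm.mul_apply, ih, pow_succ', Equiv.Perm.mul_apply]
    rfl

theorem J_pow_self {m n : ℕ} : J (m + 1) n ^ (m + 1) = 1 := by
  ext l i
  rw [J_pow_label]
  have h : (finRotate (m + 1)) ^ (m + 1) = 1 := by
    ext i
    rw [val_finRotate_pow, Nat.add_mod_right, Nat.mod_eq_of_lt i.isLt]
    rfl
  have h' : ((finRotate (m + 1)).symm) ^ (m + 1) = 1 := by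
    change ((finRotate (m + 1))⁻¹) ^ (m + 1) = 1
    rw [inv_pow, h, inv_one]
  rw [h']
  rfl

theorem J_zpow_congr {m n : ℕ} {i j : ℤ} (h : (i : ZMod (m + 1)) = j) :
    J (m + 1) n ^ i = J (m + 1) n ^ j := by
  have h1 : i ≡ j [ZMOD ((m + 1 : ℕ) : ℤ)] := (ZMod.intCast_eq_intCast_iff i j (m + 1)).mp h
  exact zpow_eq_zpow_iff_modEq.mpr
    (h1.of_dvd (by exact_mod_cast orderOf_dvd_of_pow_eq_one J_pow_self))

theorem nality_J_zpow {m n : ℕ} (i : ℤ) (l : Weight (m + 1) n) :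
    ((nality ((J (m + 1) n ^ i) l).label : ℤ) : ZMod (m + 1)) = nality l.label + i * n := by
  have h := apply_zpow_add (σ := J (m + 1) n) (d := (n : ZMod (m + 1)))
    (f := fun l => ((nality l.label : ℤ) : ZMod (m + 1))) (fun l => by
      have h1 : nality (J (m + 1) n l).label = _ := nality_rot l.label
      rw [h1, l.sum_eq]
      have h2 : (((m + 1 : ℕ) : ℤ) : ZMod (m + 1)) = 0 := by
        rw [Int.cast_natCast, ZMod.natCast_self]
      rw [Int.cast_add, Int.cast_sub, Int.cast_mul, h2]
      simp) i l
  simpa using h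

theorem stdAddChar_ne_zero {n : ℕ} [NeZero n] (a : ZMod n) : (ZMod.stdAddChar a : ℂ) ≠ 0 := by
  rw [ZMod.stdAddChar_apply]
  exact Circle.coe_ne_zero _

/-- The factor by which a row of the `SU(N)` matrix `S` changes under the simple current `J`. -/
noncomputable def suCharge {m : ℕ} (k : Fin (m + 1) → ℤ) : ℂ :=
  (-1) ^ m * ZMod.stdAddChar ((nality k : ℤ) : ZMod (m + 1))

theorem suCharge_ne_zero {m : ℕ} (k : Fin (m + 1) → ℤ) : suCharge k ≠ 0 :=
  mul_ne_zero (pow_ne_zero _ (neg_ne_zero.mpr one_ne_zero)) (stdAddChar_ne_zero _)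

theorem suS_J_zpow {m n : ℕ} (hn : n ≠ 0) (i : ℤ) (l : Weight (m + 1) n) (k : Fin (m + 1) → ℤ) :
    suS (n : ℚ) ((J (m + 1) n ^ i) l).label k = suCharge k ^ i * suS (n : ℚ) l.label k :=
  apply_zpow_mul (σ := J (m + 1) n) (f := fun l => suS (n : ℚ) l.label k)
    (suCharge_ne_zero k) (fun l => by
      rw [suS_J (n : ℚ) 1 (by exact_mod_cast hn) (by simp), suCharge, ZMod.stdAddChar_coe,
        one_mul]) i l

theorem suT_J {m n : ℕ} (hn : n ≠ 0) (l : Weight (m + 1) n) :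
    suT n (J (m + 1) n l).label = exp (Real.pi * I * (n * m) / ((m + 1 : ℕ) : ℂ)) *
      ZMod.stdAddChar (-(nality l.label : ℤ) : ZMod (m + 1)) * suT n l.label := by
  have hm : ((m + 1 : ℕ) : ℂ) ≠ 0 := by exact_mod_cast Nat.succ_ne_zero m
  have hnC : (n : ℂ) ≠ 0 := by exact_mod_cast hn
  have hJ : (J (m + 1) n l).label = l.label ∘ (finRotate (m + 1)).symm := rfl
  have h1 : ∑ i, bracket (l.label ∘ (finRotate (m + 1)).symm) i ^ 2 =
      ∑ i, bracket l.label i ^ 2 - 2 * l.label (Fin.last m) * nality l.label +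
        (m + 1) * l.label (Fin.last m) ^ 2 + n ^ 2 - 2 * n * l.label (Fin.last m) := by
    rw [← Equiv.sum_comp (finRotate (m + 1))]
    have h2 : ∀ i, bracket (l.label ∘ (finRotate (m + 1)).symm) (finRotate (m + 1) i) ^ 2 =
        bracket l.label i ^ 2 - 2 * l.label (Fin.last m) * bracket l.label i +
          l.label (Fin.last m) ^ 2 +
          if i = Fin.last m then (n : ℤ) ^ 2 - 2 * n * l.label (Fin.last m) else 0 := by
      intro i
      rw [bracket_rot, l.sum_eq]
      split_ifs with h
      · rw [h, bracket_last]
        ring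
      · ring
    simp only [h2, Finset.sum_add_distrib, Finset.sum_sub_distrib, nality_eq_sum_bracket,
      ← Finset.mul_sum]
    simp
    ring
  unfold suT
  rw [hJ, form_eq (Nat.succ_ne_zero m), form_eq (Nat.succ_ne_zero m), h1, nality_rot, l.sum_eq,
    ← Int.cast_neg, ZMod.stdAddChar_coe, ← exp_add, ← exp_add]
  congr 1
  push_cast at hm ⊢
  field_simp
  ring

theorem suT_ne_zero {N : ℕ} (n : ℕ) (l : Fin N → ℤ) : suT n l ≠ 0 := exp_ne_zero _

/-- The change of `T` under a power of `J` depends on the weight only through its `N`-ality. -/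
theorem suT_J_zpow {m n : ℕ} (hn : n ≠ 0) (i : ℤ) (l k : Weight (m + 1) n) :
    suT n ((J (m + 1) n ^ i) l).label * suT n k.label *
        ZMod.stdAddChar ((nality l.label : ℤ) : ZMod (m + 1)) ^ i =
      suT n ((J (m + 1) n ^ i) k).label * suT n l.label *
        ZMod.stdAddChar ((nality k.label : ℤ) : ZMod (m + 1)) ^ i := by
  have h0 : ∀ a : ZMod (m + 1), (ZMod.stdAddChar a : ℂ) ≠ 0 := fun a =>
    stdAddChar_ne_zero _
  -- one rotation step, with the `N`-ality after `i` steps expressed through the initial one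
  have hstep : ∀ (i : ℤ) (l : Weight (m + 1) n),
      suT n ((J (m + 1) n ^ (1 + i)) l).label *
          ZMod.stdAddChar ((nality l.label : ℤ) : ZMod (m + 1)) =
        (exp (Real.pi * I * (n * m) / ((m + 1 : ℕ) : ℂ)) *
          ZMod.stdAddChar (-(i * n) : ZMod (m + 1))) * suT n ((J (m + 1) n ^ i) l).label := by
    intro i l
    rw [zpow_add, zpow_one, Equiv.Perm.mul_apply, suT_J hn, nality_J_zpow, neg_add,
      AddChar.map_add_eq_mul]
    have h1 : (ZMod.stdAddChar (-(nality l.label : ℤ) : ZMod (m + 1)) : ℂ) *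
        ZMod.stdAddChar ((nality l.label : ℤ) : ZMod (m + 1)) = 1 := by
      rw [← AddChar.map_add_eq_mul, neg_add_cancel, AddChar.map_zero_eq_one]
    linear_combination (exp (Real.pi * I * (n * m) / ((m + 1 : ℕ) : ℂ)) *
      ZMod.stdAddChar (-(i * n) : ZMod (m + 1)) * suT n ((J (m + 1) n ^ i) l).label) * h1
  induction i using Int.induction_on with
  | zero => simp [mul_comm]
  | succ i ih =>
    have h1 := hstep i l
    have h2 := hstep i k
    rw [add_comm (i : ℤ) 1, zpow_add₀ (h0 _), zpow_add₀ (h0 _), zpow_one, zpow_one]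
    linear_combination (suT n k.label *
        ZMod.stdAddChar ((nality l.label : ℤ) : ZMod (m + 1)) ^ (i : ℤ)) * h1 -
      (suT n l.label * ZMod.stdAddChar ((nality k.label : ℤ) : ZMod (m + 1)) ^ (i : ℤ)) * h2 +
      (exp (Real.pi * I * (n * m) / ((m + 1 : ℕ) : ℂ)) *
          ZMod.stdAddChar (-((i : ℤ) * n) : ZMod (m + 1))) * ih
  | pred i ih =>
    have h1 := hstep (-(i : ℤ) - 1) l
    have h2 := hstep (-(i : ℤ) - 1) k
    have hc : exp (Real.pi * I * (n * m) / ((m + 1 : ℕ) : ℂ)) *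
          ZMod.stdAddChar (-((-(i : ℤ) - 1 : ℤ) * n) : ZMod (m + 1)) ≠ 0 :=
      mul_ne_zero (exp_ne_zero _) (h0 _)
    have e : (-(i : ℤ)) = 1 + (-(i : ℤ) - 1) := by ring
    rw [e, zpow_add₀ (h0 _), zpow_add₀ (h0 _), zpow_one, zpow_one] at ih
    refine mul_left_cancel₀ hc ?_
    linear_combination -(suT n k.label *
        ZMod.stdAddChar ((nality l.label : ℤ) : ZMod (m + 1)) ^ (-(i : ℤ) - 1)) * h1 +
      (suT n l.label *
        ZMod.stdAddChar ((nality k.label : ℤ) : ZMod (m + 1)) ^ (-(i : ℤ) - 1)) * h2 + ih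

/-! ### Simple currents of `SU(N) × SU(N)` -/

section Pairs

variable {m p q : ℕ}

/-- The simple current `J^i K^j` as a permutation. -/
def JKperm (N p q : ℕ) (i j : ℤ) : Equiv.Perm (Weight2 N p q) := (J N p ^ i).prodCongr (J N q ^ j)

theorem JKperm_apply {N : ℕ} (i j : ℤ) (x : Weight2 N p q) : JKperm N p q i j x = JKpow i j x :=
  rfl

theorem JKpow_zero {N : ℕ} (x : Weight2 N p q) : JKpow 0 0 x = x := rfl

theorem JKpow_JKpow {N : ℕ} (i j i' j' : ℤ) (x : Weight2 N p q) :
    JKpow i j (JKpow i' j' x) = JKpow (i + i') (j + j') x := by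
  simp only [JKpow, zpow_add, Equiv.Perm.mul_apply]

theorem JKpow_congr {i i' j j' : ℤ} (hi : (i : ZMod (m + 1)) = i') (hj : (j : ZMod (m + 1)) = j')
    (x : Weight2 (m + 1) p q) : JKpow i j x = JKpow i' j' x := by
  simp only [JKpow, J_zpow_congr hi, J_zpow_congr hj]

theorem JK_zpow_apply {N : ℕ} (i : ℤ) (x : Weight2 N p q) : (JK N p q ^ i) x = JKpow i i x := by
  induction i using Int.induction_on with
  | zero => rfl
  | succ i ih =>
    rw [add_comm, zpow_add, zpow_one, Equiv.Perm.mul_apply, ih]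
    exact JKpow_JKpow 1 1 _ _ x
  | pred i ih =>
    refine (JK N p q).injective ?_
    rw [← Equiv.Perm.mul_apply, ← zpow_one_add, add_sub_cancel, ih]
    refine Eq.trans ?_ (JKpow_JKpow 1 1 (-(i : ℤ) - 1) (-(i : ℤ) - 1) x).symm
    rw [add_sub_cancel]

/-- The charge `t(μ) - r t(λ)` modulo `N`, whose zero locus is `Φ_{WN}^{p,q}`. -/
def pairCharge (r : ℤ) (x : Weight2 (m + 1) p q) : ZMod (m + 1) :=
  (nality x.2.label : ℤ) - r * (nality x.1.label : ℤ)

theorem mem_WReps_iff {r : ℤ} {x : Weight2 (m + 1) p q} :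
    x ∈ WReps (m + 1) p q r ↔ pairCharge r x = 0 := by
  unfold pairCharge
  rw [sub_eq_zero, ← Int.cast_mul, ZMod.intCast_eq_intCast_iff]
  rfl

theorem pairCharge_JKpow (r i j : ℤ) (x : Weight2 (m + 1) p q) :
    pairCharge r (JKpow i j x) = pairCharge r x + (j * q - r * i * p) := by
  unfold pairCharge JKpow
  simp only [nality_J_zpow]
  ring

theorem pairCharge_current (r a : ℤ) (x : Weight2 (m + 1) p q) :
    pairCharge r (JKpow (a * r) (-a) x) = pairCharge r x - a * (r ^ 2 * p + q) := by
  rw [pairCharge_JKpow]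
  push_cast
  ring

/-! ### The matrices `S` and `T` of `SU(N) × SU(N)` -/

/-- The matrix `S` of `SU(N) × SU(N)` without normalising constants. -/
noncomputable def pairS (x y : Weight2 (m + 1) p q) : ℂ :=
  suS (p : ℚ) x.1.label y.1.label * suS (q : ℚ) x.2.label y.2.label

/-- The diagonal of the matrix `T` of `SU(N) × SU(N)` without normalising constants. -/
noncomputable def pairT (x : Weight2 (m + 1) p q) : ℂ := suT p x.1.label * suT q x.2.label

/-- The entries `pairS` as a matrix. -/
noncomputable def pairMatrixS (m p q : ℕ) : Matrix (Weight2 (m + 1) p q) (Weight2 (m + 1) p q) ℂ :=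
  Matrix.of pairS

theorem pairMatrixS_apply (x y : Weight2 (m + 1) p q) : pairMatrixS m p q x y = pairS x y := rfl

theorem S2_eq_smul (βp βq : ℂ) :
    S2 (m + 1) p q βp βq = (βp * βq) • pairMatrixS m p q := by
  ext x y
  simp only [S2, pairMatrixS_apply, pairS, Matrix.of_apply, Matrix.smul_apply, smul_eq_mul]
  ring

theorem S2_comm_iff {βp βq : ℂ} (hβp : βp ≠ 0) (hβq : βq ≠ 0)
    (M : Matrix (Weight2 (m + 1) p q) (Weight2 (m + 1) p q) ℂ) :
    S2 (m + 1) p q βp βq * M = M * S2 (m + 1) p q βp βq ↔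
      pairMatrixS m p q * M = M * pairMatrixS m p q := by
  rw [S2_eq_smul, Matrix.smul_mul, Matrix.mul_smul]
  exact (smul_right_injective _ (mul_ne_zero hβp hβq)).eq_iff

theorem diagonal_comm_iff {Φ : Type*} [Fintype Φ] [DecidableEq Φ] {c : ℂ} (hc : c ≠ 0) (d : Φ → ℂ)
    (M : Matrix Φ Φ ℂ) :
    (Matrix.diagonal fun x => c * d x) * M = M * (Matrix.diagonal fun x => c * d x) ↔
      ∀ x y, M x y ≠ 0 → d x = d y := by
  have h : ∀ x y, ((Matrix.diagonal fun x => c * d x) * M) x y =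
      (M * (Matrix.diagonal fun x => c * d x)) x y ↔ (M x y ≠ 0 → d x = d y) := by
    intro x y
    rw [Matrix.diagonal_mul, Matrix.mul_diagonal, mul_comm (M x y)]
    by_cases h0 : M x y = 0
    · simp [h0]
    · simp [h0, hc]
  constructor
  · intro h1 x y
    exact (h x y).mp (by rw [h1])
  · intro h1
    ext x y
    exact (h x y).mpr (h1 x y)

theorem T2_comm_iff {αp αq : ℂ} (hαp : αp ≠ 0) (hαq : αq ≠ 0)
    (M : Matrix (Weight2 (m + 1) p q) (Weight2 (m + 1) p q) ℂ) :
    T2 (m + 1) p q αp αq * M = M * T2 (m + 1) p q αp αq ↔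
      ∀ x y, M x y ≠ 0 → pairT x = pairT y := by
  rw [← diagonal_comm_iff (mul_ne_zero hαp hαq)]
  have h : T2 (m + 1) p q αp αq =
      Matrix.diagonal fun x : Weight2 (m + 1) p q => (αp * αq) * pairT x := by
    unfold T2 pairT
    congr 1
    funext x
    ring
  rw [h]

theorem pairS_comm (x y : Weight2 (m + 1) p q) : pairS x y = pairS y x := by
  unfold pairS
  rw [suS_comm, suS_comm (q : ℚ)]

theorem pairS_mul_conjTranspose (hp : p ≠ 0) (hq : q ≠ 0) :
    pairMatrixS m p q *
      (pairMatrixS m p q).conjTranspose =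
        ((((m + 1 : ℕ) : ℂ) * (p : ℂ) ^ m) * (((m + 1 : ℕ) : ℂ) * (q : ℂ) ^ m)) • 1 := by
  ext x y
  rw [Matrix.mul_apply, Fintype.sum_prod_type]
  have h : ∀ k l, pairMatrixS m p q x (k, l) * (pairMatrixS m p q).conjTranspose (k, l) y =
      (suS (p : ℚ) x.1.label k.label * (starRingEnd ℂ) (suS (p : ℚ) y.1.label k.label)) *
      (suS (q : ℚ) x.2.label l.label * (starRingEnd ℂ) (suS (q : ℚ) y.2.label l.label)) := by
    intro k l
    rw [Matrix.conjTranspose_apply, pairMatrixS_apply, pairMatrixS_apply, pairS, pairS, star_mul]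
    simp only [Complex.star_def]
    ring
  simp only [h, ← Finset.mul_sum, ← Finset.sum_mul]
  rw [sum_suS_mul_conj hp, sum_suS_mul_conj hq, Matrix.smul_apply, Matrix.one_apply,
    smul_eq_mul]
  by_cases h1 : x.1 = y.1 <;> by_cases h2 : x.2 = y.2 <;> simp [h1, h2, Prod.ext_iff]

theorem pairS_JKpow (hp : p ≠ 0) (hq : q ≠ 0) (i j : ℤ) (x y : Weight2 (m + 1) p q) :
    pairS (JKpow i j x) y = suCharge y.1.label ^ i * suCharge y.2.label ^ j * pairS x y := by
  unfold pairS JKpow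
  rw [suS_J_zpow hp, suS_J_zpow hq]
  ring

theorem stdAddChar_zpow {n : ℕ} [NeZero n] (a : ZMod n) (i : ℤ) :
    (ZMod.stdAddChar a : ℂ) ^ i = ZMod.stdAddChar ((i : ZMod n) * a) := by
  rw [← zsmul_eq_mul, AddChar.map_zsmul_eq_zpow]

/-- The factor by which a row of `S` changes under the simple current `J^{-r} K`. -/
theorem suCharge_zpow_mul (r : ℤ) (y : Weight2 (m + 1) p q) :
    suCharge y.1.label ^ (-r) * suCharge y.2.label ^ (1 : ℤ) =
      ((-1 : ℂ) ^ m) ^ (1 - r) * ZMod.stdAddChar (pairCharge r y) := by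
  have h1 : ((-1 : ℂ) ^ m) ≠ 0 := pow_ne_zero _ (neg_ne_zero.mpr one_ne_zero)
  unfold suCharge pairCharge
  rw [mul_zpow, mul_zpow, stdAddChar_zpow, zpow_one, zpow_one, sub_eq_neg_add 1 r,
    zpow_add₀ h1, zpow_one, sub_eq_neg_add, AddChar.map_add_eq_mul]
  push_cast
  rw [neg_mul]
  ring

/-- The change of `T` under `J^{-r} K` depends on the weight only through its charge. -/
theorem pairT_current (hp : p ≠ 0) (hq : q ≠ 0) (r : ℤ) {x y : Weight2 (m + 1) p q}
    (h : pairCharge r x = pairCharge r y) :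
    pairT (JKpow (-r) 1 x) * pairT y = pairT (JKpow (-r) 1 y) * pairT x := by
  have h1 := suT_J_zpow hp (-r) x.1 y.1
  have h2 := suT_J_zpow hq 1 x.2 y.2
  rw [stdAddChar_zpow, stdAddChar_zpow] at h1 h2
  have h3 : ∀ z : Weight2 (m + 1) p q,
      (ZMod.stdAddChar (((-r : ℤ) : ZMod (m + 1)) * ((nality z.1.label : ℤ) : ZMod (m + 1))) : ℂ) *
        ZMod.stdAddChar (((1 : ℤ) : ZMod (m + 1)) * ((nality z.2.label : ℤ) : ZMod (m + 1))) =
        ZMod.stdAddChar (pairCharge r z) := by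
    intro z
    rw [← AddChar.map_add_eq_mul, pairCharge]
    congr 1
    push_cast
    ring
  have hx := h3 x
  have hy := h3 y
  rw [← h] at hy
  refine mul_right_cancel₀ (stdAddChar_ne_zero (pairCharge r x)) ?_
  unfold pairT JKpow
  rw [← hx] at hy
  rw [← hx]
  have h4 := congrArg₂ (· * ·) h1 h2
  linear_combination h4 + (suT p ((J (m + 1) p ^ (-r)) y.1).label *
    suT q ((J (m + 1) q ^ (1 : ℤ)) y.2).label * suT p x.1.label * suT q x.2.label) * hy

theorem pairT_ne_zero (x : Weight2 (m + 1) p q) : pairT x ≠ 0 :=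
  mul_ne_zero (suT_ne_zero _ _) (suT_ne_zero _ _)

theorem pairT_current_eq_iff (hp : p ≠ 0) (hq : q ≠ 0) (r : ℤ) {x y : Weight2 (m + 1) p q}
    (h : pairCharge r x = pairCharge r y) :
    pairT (JKpow (-r) 1 x) = pairT (JKpow (-r) 1 y) ↔ pairT x = pairT y := by
  have h1 := pairT_current hp hq r h
  constructor
  · intro h2
    rw [h2] at h1
    exact (mul_left_cancel₀ (pairT_ne_zero _) h1).symm
  · intro h2
    rw [h2] at h1
    exact mul_right_cancel₀ (pairT_ne_zero _) h1

end Pairs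

/-! ### The Galois automorphism relating `W_N(p,q)` to `SU(N) × SU(N)` -/

theorem exists_mul_eq_add {a b : ℤ} (h : IsCoprime a b) (c : ℤ) : ∃ k t : ℤ, a * k = c + b * t := by
  obtain ⟨s, t, hst⟩ := h
  exact ⟨s * c, -(t * c), by linear_combination c * hst⟩

/-- The exponent of a Galois automorphism that turns the `SU(N) × SU(N)` modular data on
`Φ_{WN}^{p,q}` into that of `W_N(p,q)`. The integers `u`, `v`, `c` of the first condition serve to
compare the matrices `S`, where only `u + v r² + 2r ≡ 0` modulo `N` matters. The parity of `c` is
what the matrices `T` require in addition. -/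
structure IsGaloisExponent (N p q : ℕ) (r ℓ : ℤ) : Prop where
  exists_coeff : ∃ u v c d : ℤ, ℓ = q + p * u ∧ ℓ = p + q * v ∧
    u + v * r ^ 2 + 2 * r = c * N ∧ c = u + v * r + 2 * d
  coprime : IsCoprime ℓ (2 * (N * p * q : ℤ))

/-- Solving `(r + 1)² + k (r² p + q) ≡ 0` modulo `N` for `k` gives the exponent `p + q + pqk`; it is
coprime to `N` because its product with `r² p + q` is `(rp - q)²` modulo `N`. -/
theorem exists_isGaloisExponent {N p q : ℕ} {r : ℤ} (hpq : Nat.Coprime p q)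
    (hr : Admissible N p q r) : ∃ ℓ, IsGaloisExponent N p q r ℓ := by
  have hpq' : IsCoprime (p : ℤ) q := Nat.isCoprime_iff_coprime.mpr hpq
  obtain ⟨hr1, hr2⟩ := hr
  set g : ℤ := r ^ 2 * p + q with hg
  have hg2 : Odd g := Int.isCoprime_two_right.mp hr2.of_mul_right_left
  have hgN : IsCoprime g N := hr2.of_mul_right_right
  have hr1N : IsCoprime (r * p - q) (N : ℤ) := hr1.of_mul_right_right
  -- it suffices to find `k` for `ℓ = p + q + pqk`
  have main : ∀ k c d : ℤ, (r + 1) ^ 2 + k * g = c * N → c = (1 + q * k) + (1 + p * k) * r + 2 * d →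
      (Odd (N : ℤ) → Odd (p + q + p * q * k : ℤ)) → ∃ ℓ, IsGaloisExponent N p q r ℓ := by
    intro k c d h1 h2 h3
    have hN : IsCoprime (p + q + p * q * k : ℤ) N := by
      have h4 : (p + q + p * q * k : ℤ) * g = (r * p - q) ^ 2 + N * (p * q * c) := by
        linear_combination ((p : ℤ) * q) * h1
      have h5 : IsCoprime ((p + q + p * q * k : ℤ) * g) N := by
        rw [h4]
        exact IsCoprime.add_mul_left_left hr1N.pow_left _
      exact h5.of_mul_left_left
    refine ⟨p + q + p * q * k, ⟨1 + q * k, 1 + p * k, c, d, by ring, by ring, ?_, h2⟩, ?_⟩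
    · rw [← h1, hg]
      ring
    · have hp : IsCoprime (p + q + p * q * k : ℤ) p := by
        have : (p + q + p * q * k : ℤ) = q + p * (1 + q * k) := by ring
        rw [this]
        exact IsCoprime.add_mul_left_left hpq'.symm _
      have hq : IsCoprime (p + q + p * q * k : ℤ) q := by
        have : (p + q + p * q * k : ℤ) = p + q * (1 + p * k) := by ring
        rw [this]
        exact IsCoprime.add_mul_left_left hpq' _
      refine IsCoprime.mul_right ?_ ((hN.mul_right hp).mul_right hq)
      rcases Int.even_or_odd (N : ℤ) with hE | hO
      · obtain ⟨e, he⟩ := hE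
        rw [he, ← two_mul] at hN
        exact hN.of_mul_right_left
      · exact Int.isCoprime_two_right.mpr (h3 hO)
  rcases Int.even_or_odd (N : ℤ) with ⟨e, he⟩ | ⟨e, he⟩
  · have hN2 : (N : ℤ) = 2 * e := by linarith
    have hco : IsCoprime (g - N * (q + r * p)) (2 * N) := by
      refine IsCoprime.mul_right ?_ ?_
      · have : g - N * (q + r * p) = g + 2 * (-(e * (q + r * p))) := by rw [hN2]; ring
        rw [this]
        exact IsCoprime.add_mul_left_left hr2.of_mul_right_left _
      · have : g - N * (q + r * p) = g + N * (-(q + r * p)) := by ring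
        rw [this]
        exact IsCoprime.add_mul_left_left hgN _
    obtain ⟨k, t, hk⟩ := exists_mul_eq_add hco (N * (1 + r) - (r + 1) ^ 2)
    refine main k (1 + r + (q + r * p) * k + 2 * t) t (by linear_combination hk) (by ring) ?_
    intro hO
    exact absurd hO (Int.not_odd_iff_even.mpr ⟨e, he⟩)
  · obtain ⟨k, t, hk⟩ := exists_mul_eq_add hr2 (N * r - (r + 1) ^ 2)
    obtain ⟨f, hf⟩ : ∃ f, r ^ 2 - r = 2 * f := by
      obtain ⟨f, hf⟩ := Int.even_mul_succ_self (r - 1)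
      exact ⟨f, by linear_combination hf⟩
    have h1 : (r + 1) ^ 2 + k * g = (r + 2 * t) * N := by linear_combination hk
    refine main k (r + 2 * t) ((1 + p * k) * f + r - e * (r + 2 * t)) h1 ?_ fun _ => ?_
    · linear_combination -(r + 2 * t) * he - h1 + k * hg + (1 + p * k) * hf
    · have hkodd : Odd k := by
        have h2 : Odd (g * k) := by
          rw [hk, he]
          refine ⟨e * r + e * 2 * t + t - f - 2 * r + r - 1, ?_⟩
          linear_combination -hf
        exact (Int.odd_mul.mp h2).2
      rcases Int.even_or_odd (p : ℤ) with hpE | hpO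
      · have hqO : Odd (q : ℤ) := by
          obtain ⟨a, ha⟩ := hpE
          rw [ha, ← two_mul] at hpq'
          exact Int.isCoprime_two_left.mp hpq'.of_mul_left_left
        exact (hpE.add_odd hqO).add_even ((hpE.mul_right _).mul_right _)
      · rcases Int.even_or_odd (q : ℤ) with hqE | hqO
        · exact (hpO.add_even hqE).add_even ((hqE.mul_left _).mul_right _)
        · exact (hpO.add_odd hqO).add_odd ((hpO.mul hqO).mul hkodd)

section Galois

variable {m p q : ℕ}

theorem exp_int_div_eq_iff {a b : ℤ} {L : ℕ} (hL : L ≠ 0) :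
    exp (Real.pi * I * a / L) = exp (Real.pi * I * b / L) ↔ (2 * L : ℤ) ∣ a - b := by
  have hLC : (L : ℂ) ≠ 0 := by exact_mod_cast hL
  have hpi : (Real.pi : ℂ) * I ≠ 0 := mul_ne_zero (by exact_mod_cast Real.pi_ne_zero) I_ne_zero
  rw [exp_eq_exp_iff_exists_int]
  constructor
  · rintro ⟨n, hn⟩
    refine ⟨n, ?_⟩
    have h : (a : ℂ) - b = 2 * L * n := by
      refine mul_left_cancel₀ hpi ?_
      field_simp at hn
      linear_combination (Real.pi : ℂ) * I * hn
    exact_mod_cast h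
  · rintro ⟨n, hn⟩
    refine ⟨n, ?_⟩
    have h : (a : ℂ) - b = 2 * L * n := by exact_mod_cast hn
    rw [eq_add_of_sub_eq h]
    field_simp
    ring

/-- The integer `E` with `T_{λμ} = exp (πi E / (Npq))` for `SU(N) × SU(N)`. -/
def pairTExponent (x : Weight2 (m + 1) p q) : ℤ :=
  q * (((m + 1 : ℕ) : ℤ) * ∑ i, bracket x.1.label i ^ 2 - nality x.1.label ^ 2) +
    p * (((m + 1 : ℕ) : ℤ) * ∑ i, bracket x.2.label i ^ 2 - nality x.2.label ^ 2)

/-- The integer `E` with `T_{[λμ]} = exp (πi E / (Npq))` for `W_N(p,q)`. -/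
def wTExponent (x : Weight2 (m + 1) p q) : ℤ :=
  ((m + 1 : ℕ) : ℤ) * ∑ i, (q * bracket x.1.label i - p * bracket x.2.label i) ^ 2 -
    (q * nality x.1.label - p * nality x.2.label) ^ 2

theorem pairT_eq_exp (hp : p ≠ 0) (hq : q ≠ 0) (x : Weight2 (m + 1) p q) :
    pairT x = exp (Real.pi * I * pairTExponent x / ((m + 1) * p * q : ℕ)) := by
  have hm : ((m + 1 : ℕ) : ℂ) ≠ 0 := by exact_mod_cast Nat.succ_ne_zero m
  have hpC : (p : ℂ) ≠ 0 := by exact_mod_cast hp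
  have hqC : (q : ℂ) ≠ 0 := by exact_mod_cast hq
  unfold pairT suT pairTExponent
  rw [← exp_add, form_eq (Nat.succ_ne_zero m), form_eq (Nat.succ_ne_zero m)]
  congr 1
  generalize ∑ i, bracket x.1.label i ^ 2 = A
  generalize ∑ i, bracket x.2.label i ^ 2 = B
  push_cast at hm ⊢
  field_simp

theorem bracket_sub_mul {N : ℕ} (a b : ℤ) (l k : Fin N → ℤ) (i : Fin N) :
    bracket (fun i => a * l i - b * k i) i = a * bracket l i - b * bracket k i := by
  unfold bracket
  rw [Finset.mul_sum, Finset.mul_sum, ← Finset.sum_sub_distrib]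
  refine Finset.sum_congr rfl fun j _ => ?_
  split_ifs <;> simp

theorem nality_sub_mul {N : ℕ} (a b : ℤ) (l k : Fin N → ℤ) :
    nality (fun i => a * l i - b * k i) = a * nality l - b * nality k := by
  unfold nality
  rw [Finset.mul_sum, Finset.mul_sum, ← Finset.sum_sub_distrib]
  exact Finset.sum_congr rfl fun j _ => by ring

theorem wTrep_eq_exp (hp : p ≠ 0) (hq : q ≠ 0) (x : Weight2 (m + 1) p q) :
    wTrep x = exp (Real.pi * I * wTExponent x / ((m + 1) * p * q : ℕ)) := by
  have hm : ((m + 1 : ℕ) : ℂ) ≠ 0 := by exact_mod_cast Nat.succ_ne_zero m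
  have hpC : (p : ℂ) ≠ 0 := by exact_mod_cast hp
  have hqC : (q : ℂ) ≠ 0 := by exact_mod_cast hq
  unfold wTrep wTExponent
  rw [form_eq (Nat.succ_ne_zero m), nality_sub_mul]
  simp only [bracket_sub_mul]
  congr 1
  generalize ∑ i, (q * bracket x.1.label i - p * bracket x.2.label i) ^ 2 = A
  push_cast at hm ⊢
  field_simp

theorem exists_sum_sq_sub_nality {N : ℕ} (l : Fin N → ℤ) :
    ∃ e, ∑ i, bracket l i ^ 2 = nality l + 2 * e := by
  have h : ∀ i, ∃ e, bracket l i ^ 2 = bracket l i + 2 * e := by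
    intro i
    obtain ⟨e, he⟩ := Int.even_mul_succ_self (bracket l i - 1)
    exact ⟨e, by linear_combination he⟩
  choose e he using h
  refine ⟨∑ i, e i, ?_⟩
  rw [nality_eq_sum_bracket, Finset.mul_sum, ← Finset.sum_add_distrib]
  exact Finset.sum_congr rfl fun i _ => he i

/-- On `Φ_{WN}^{p,q}`, the matrix `T` of `W_N(p,q)` is the `ℓ`-th power of that of
`SU(N) × SU(N)`. -/
theorem two_mul_dvd_wTExponent_sub {r ℓ : ℤ} (hℓ : IsGaloisExponent (m + 1) p q r ℓ)
    {x : Weight2 (m + 1) p q} (hx : x ∈ WReps (m + 1) p q r) :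
    (2 * ((m + 1) * p * q : ℕ) : ℤ) ∣ wTExponent x - ℓ * pairTExponent x := by
  obtain ⟨u, v, c, d, h1, h2, h3, h4⟩ := hℓ.exists_coeff
  obtain ⟨s, hs⟩ := Int.modEq_iff_dvd.mp (Int.ModEq.symm hx)
  obtain ⟨e1, he1⟩ := exists_sum_sq_sub_nality x.1.label
  obtain ⟨e2, he2⟩ := exists_sum_sq_sub_nality x.2.label
  have hexp : ∑ i, (q * bracket x.1.label i - p * bracket x.2.label i) ^ 2 =
      q ^ 2 * ∑ i, bracket x.1.label i ^ 2 + p ^ 2 * ∑ i, bracket x.2.label i ^ 2 -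
        2 * p * q * ∑ i, bracket x.1.label i * bracket x.2.label i := by
    simp only [Finset.mul_sum, ← Finset.sum_add_distrib, ← Finset.sum_sub_distrib]
    exact Finset.sum_congr rfl fun i _ => by ring
  unfold wTExponent pairTExponent
  rw [hexp, he1, he2]
  generalize ∑ i, bracket x.1.label i * bracket x.2.label i = X
  set t := nality x.1.label
  have hs' : nality x.2.label = r * t + ((m + 1 : ℕ) : ℤ) * s := by linarith
  rw [hs']
  obtain ⟨f, hf⟩ : ∃ f, t ^ 2 - t = 2 * f := by
    obtain ⟨f, hf⟩ := Int.even_mul_succ_self (t - 1)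
    exact ⟨f, by linear_combination hf⟩
  obtain ⟨k, hk⟩ : ∃ k, s ^ 2 - s = 2 * k := by
    obtain ⟨k, hk⟩ := Int.even_mul_succ_self (s - 1)
    exact ⟨k, by linear_combination hk⟩
  obtain ⟨y, hy⟩ : ∃ y : ℤ, c * t ^ 2 + 2 * v * r * t * s + v * ((m + 1 : ℕ) : ℤ) * s ^ 2 +
      2 * t * s - u * (t + 2 * e1) -
      v * (r * t + ((m + 1 : ℕ) : ℤ) * s + 2 * e2) - 2 * X = 2 * y := by
    refine ⟨c * f + d * t + v * r * t * s + v * ((m + 1 : ℕ) : ℤ) * k + t * s -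
      u * e1 - v * e2 - X, ?_⟩
    linear_combination c * hf + t * h4 + v * ((m + 1 : ℕ) : ℤ) * hk
  refine ⟨y, ?_⟩
  generalize hN : ((m + 1 : ℕ) : ℤ) = N at *
  have h5 : (((m + 1) * p * q : ℕ) : ℤ) = N * p * q := by
    rw [← hN]
    push_cast
    ring
  rw [h5]
  linear_combination (N * p * q) * hy - (q * (N * (t + 2 * e1) - t ^ 2)) * h1 -
    (p * (N * (r * t + N * s + 2 * e2) - (r * t + N * s) ^ 2)) * h2 + (p * q * t ^ 2) * h3

/-- On `Φ_{WN}^{p,q}`, the matrices `T` of `W_N(p,q)` and of `SU(N) × SU(N)` have the same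
coincidences of eigenvalues: one is a power of the other, with exponent coprime to the order. -/
theorem wTrep_eq_iff (hp : p ≠ 0) (hq : q ≠ 0) {r ℓ : ℤ}
    (hℓ : IsGaloisExponent (m + 1) p q r ℓ) {x y : Weight2 (m + 1) p q}
    (hx : x ∈ WReps (m + 1) p q r) (hy : y ∈ WReps (m + 1) p q r) :
    wTrep x = wTrep y ↔ pairT x = pairT y := by
  have hL : (m + 1) * p * q ≠ 0 := by positivity
  rw [wTrep_eq_exp hp hq, wTrep_eq_exp hp hq, pairT_eq_exp hp hq, pairT_eq_exp hp hq,
    exp_int_div_eq_iff hL, exp_int_div_eq_iff hL]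
  have h1 := two_mul_dvd_wTExponent_sub hℓ hx
  have h2 := two_mul_dvd_wTExponent_sub hℓ hy
  have h3 : wTExponent x - wTExponent y = ℓ * (pairTExponent x - pairTExponent y) +
      ((wTExponent x - ℓ * pairTExponent x) - (wTExponent y - ℓ * pairTExponent y)) := by ring
  rw [h3, dvd_add_left (dvd_sub h1 h2)]
  refine ⟨fun h => IsCoprime.dvd_of_dvd_mul_left ?_ h, fun h => dvd_mul_of_dvd_right h _⟩
  have h4 := hℓ.coprime.symm
  push_cast at h4 ⊢
  exact h4

/-! ### Embeddings of a cyclotomic field -/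

/-- The `SU(N) × SU(N)` matrix `S` with `exp (2πi / (Npq))` replaced by `z`. -/
noncomputable def fieldS {K : Type*} [Field K] (z : K) (x y : Weight2 (m + 1) p q) : K :=
  z ^ (q * (nality x.1.label * nality y.1.label) + p * (nality x.2.label * nality y.2.label)) *
    (Matrix.of fun i j => z ^ (-(((m + 1 : ℕ) : ℤ) * q *
      (bracket x.1.label i * bracket y.1.label j)))).det *
    (Matrix.of fun i j => z ^ (-(((m + 1 : ℕ) : ℤ) * p *
      (bracket x.2.label i * bracket y.2.label j)))).det

theorem map_fieldS {K F : Type*} [Field K] [Field F] (φ : K →+* F) (z : K)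
    (x y : Weight2 (m + 1) p q) : φ (fieldS z x y) = fieldS (φ z) x y := by
  unfold fieldS
  rw [map_mul, map_mul, map_zpow₀, RingHom.map_det, RingHom.map_det]
  congr 2
  · congr 2
    ext i j
    simp
  · ext i j
    simp

theorem fieldS_exp (hp : p ≠ 0) (hq : q ≠ 0) (x y : Weight2 (m + 1) p q) :
    fieldS (exp (2 * Real.pi * I / ((m + 1) * p * q : ℕ))) x y = pairS x y := by
  have hm : ((m + 1 : ℕ) : ℂ) ≠ 0 := by exact_mod_cast Nat.succ_ne_zero m
  have hpC : (p : ℂ) ≠ 0 := by exact_mod_cast hp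
  have hqC : (q : ℂ) ≠ 0 := by exact_mod_cast hq
  unfold fieldS pairS suS
  simp only [← exp_int_mul]
  have e1 : ∀ a b c d : ℂ, a * b * (c * d) = a * c * b * d := by
    intros; ring
  rw [e1, ← exp_add]
  congr 1
  · congr 1
    · congr 1
      push_cast at hm ⊢
      field_simp
    · congr 1
      ext i j
      simp only [Matrix.of_apply]
      congr 1
      push_cast at hm ⊢
      field_simp
  · congr 1
    ext i j
    simp only [Matrix.of_apply]
    congr 1
    push_cast at hm ⊢
    field_simp

/-- On `Φ_{WN}^{p,q}`, the entries of the `W_N(p,q)` matrix `S` arise from those of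
`SU(N) × SU(N)` by raising the root of unity to the power `ℓ`. -/
theorem fieldS_exp_pow (hp : p ≠ 0) (hq : q ≠ 0) {r ℓ : ℤ}
    (hℓ : IsGaloisExponent (m + 1) p q r ℓ) {x y : Weight2 (m + 1) p q}
    (hx : x ∈ WReps (m + 1) p q r) (hy : y ∈ WReps (m + 1) p q r) :
    fieldS (exp (2 * Real.pi * I / ((m + 1) * p * q : ℕ)) ^ ℓ) x y = wSrep x y := by
  have hm : ((m + 1 : ℕ) : ℂ) ≠ 0 := by exact_mod_cast Nat.succ_ne_zero m
  have hpC : (p : ℂ) ≠ 0 := by exact_mod_cast hp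
  have hqC : (q : ℂ) ≠ 0 := by exact_mod_cast hq
  obtain ⟨u, v, c, d, h1, h2, h3, -⟩ := hℓ.exists_coeff
  obtain ⟨s, hs⟩ := Int.modEq_iff_dvd.mp (Int.ModEq.symm hx)
  obtain ⟨s', hs'⟩ := Int.modEq_iff_dvd.mp (Int.ModEq.symm hy)
  have h1C : (ℓ : ℂ) = q + p * u := by exact_mod_cast h1
  have h2C : (ℓ : ℂ) = p + q * v := by exact_mod_cast h2
  unfold fieldS wSrep suS
  simp only [← exp_int_mul]
  have e1 : ∀ a b c d e : ℂ, a * (b * c) * (d * e) = (a * b * d) * c * e := by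
    intros; ring
  rw [e1, ← exp_add, ← exp_add]
  congr 1
  · congr 1
    · rw [exp_eq_exp_iff_exists_int]
      refine ⟨c * nality x.1.label * nality y.1.label +
        (v * r + 1) * (nality x.1.label * s' + s * nality y.1.label) +
        v * ((m + 1 : ℕ) : ℤ) * s * s', ?_⟩
      have h3C : (u : ℂ) + v * r ^ 2 + 2 * r = c * ((m + 1 : ℕ) : ℂ) := by exact_mod_cast h3
      have hsC : (nality x.2.label : ℂ) = r * nality x.1.label + ((m + 1 : ℕ) : ℂ) * s := by
        have : nality x.2.label = r * nality x.1.label + ((m + 1 : ℕ) : ℤ) * s := by linarith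
        exact_mod_cast this
      have hsC' : (nality y.2.label : ℂ) = r * nality y.1.label + ((m + 1 : ℕ) : ℂ) * s' := by
        have : nality y.2.label = r * nality y.1.label + ((m + 1 : ℕ) : ℤ) * s' := by linarith
        exact_mod_cast this
      -- the first summand of the exponent uses `ℓ = q + pu`, the second one `ℓ = p + qv`
      have e2 : (ℓ : ℂ) * (q * (nality x.1.label * nality y.1.label) +
            p * (nality x.2.label * nality y.2.label)) =
          (q + p * u) * (q * (nality x.1.label * nality y.1.label)) +
            (p + q * v) * (p * (nality x.2.label * nality y.2.label)) := by
        rw [mul_add, ← h1C, ← h2C]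
      push_cast at hm h3C hsC hsC' ⊢
      rw [hsC, hsC'] at e2 ⊢
      field_simp
      linear_combination e2 + (p * q * nality x.1.label * nality y.1.label : ℂ) * h3C
    · congr 1
      ext i j
      simp only [Matrix.of_apply]
      rw [exp_eq_exp_iff_exists_int]
      refine ⟨-(u * (bracket x.1.label i * bracket y.1.label j)), ?_⟩
      push_cast at hm ⊢
      rw [h1C]
      field_simp
      ring
  · congr 1
    ext i j
    simp only [Matrix.of_apply]
    rw [exp_eq_exp_iff_exists_int]
    refine ⟨-(v * (bracket x.2.label i * bracket y.2.label j)), ?_⟩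
    push_cast at hm ⊢
    rw [h2C]
    field_simp
    ring

/-- Commutation with a matrix of natural numbers is preserved and reflected by field embeddings. -/
theorem natMatrix_comm_map_iff {ι K F : Type*} [Fintype ι] [DecidableEq ι] [Field K] [Field F]
    (φ : K →+* F) (S : Matrix ι ι K) (μ : Matrix ι ι ℕ) :
    S.map φ * μ.map (Nat.cast : ℕ → F) = μ.map (Nat.cast : ℕ → F) * S.map φ ↔
      S * μ.map (Nat.cast : ℕ → K) = μ.map (Nat.cast : ℕ → K) * S := by
  have h : μ.map (Nat.cast : ℕ → F) = (μ.map (Nat.cast : ℕ → K)).map φ := by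
    ext i j
    simp
  rw [h, ← Matrix.map_mul, ← Matrix.map_mul]
  exact (Matrix.map_injective φ.injective).eq_iff

/-- Two primitive roots of unity of the same order are images of one element under two
embeddings of a field, namely a cyclotomic field. -/
theorem exists_two_embeddings {L : ℕ} [NeZero L] {z w : ℂ} (hz : IsPrimitiveRoot z L)
    (hw : IsPrimitiveRoot w L) :
    ∃ (K : Type) (_ : Field K) (ζ : K) (φ ψ : K →+* ℂ), φ ζ = z ∧ ψ ζ = w := by
  have : IsCyclotomicExtension {L} ℚ (CyclotomicField L ℚ) :=
    CyclotomicField.isCyclotomicExtension L ℚ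
  have hζ := IsCyclotomicExtension.zeta_spec L ℚ (CyclotomicField L ℚ)
  have hirr := Polynomial.cyclotomic.irreducible_rat (NeZero.pos L)
  have hemb : ∀ z : ℂ, IsPrimitiveRoot z L → ∃ φ : CyclotomicField L ℚ →+* ℂ,
      φ (IsCyclotomicExtension.zeta L ℚ (CyclotomicField L ℚ)) = z := by
    intro z hz
    have hz' : z ∈ primitiveRoots L ℂ := (mem_primitiveRoots (NeZero.pos L)).mpr hz
    refine ⟨((hζ.embeddingsEquivPrimitiveRoots ℂ hirr).symm ⟨z, hz'⟩).toRingHom, ?_⟩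
    have h := hζ.embeddingsEquivPrimitiveRoots_apply_coe ℂ hirr
      ((hζ.embeddingsEquivPrimitiveRoots ℂ hirr).symm ⟨z, hz'⟩)
    rw [Equiv.apply_symm_apply] at h
    exact h.symm
  obtain ⟨φ, hφ⟩ := hemb z hz
  obtain ⟨ψ, hψ⟩ := hemb w hw
  exact ⟨_, _, _, φ, ψ, hφ, hψ⟩

/-- A matrix of natural numbers on `Φ_{WN}^{p,q}` commutes with the matrix `S` of `W_N(p,q)` if and
only if it commutes with the one of `SU(N) × SU(N)`, since the two are Galois conjugate. -/
theorem wSrep_comm_iff (hp : p ≠ 0) (hq : q ≠ 0) {r ℓ : ℤ}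
    (hℓ : IsGaloisExponent (m + 1) p q r ℓ)
    (B : Matrix (WReps (m + 1) p q r) (WReps (m + 1) p q r) ℂ) [Fintype (WReps (m + 1) p q r)]
    (hB : ∀ x y, ∃ k : ℕ, B x y = k) :
    (Matrix.of fun x y : WReps (m + 1) p q r => wSrep x.1 y.1) * B =
        B * (Matrix.of fun x y : WReps (m + 1) p q r => wSrep x.1 y.1) ↔
      (Matrix.of fun x y : WReps (m + 1) p q r => pairS x.1 y.1) * B =
        B * (Matrix.of fun x y : WReps (m + 1) p q r => pairS x.1 y.1) := by
  classical
  set L : ℕ := (m + 1) * p * q with hLdef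
  have hL : L ≠ 0 := by positivity
  have : NeZero L := ⟨hL⟩
  choose μ hμ using hB
  have hBμ : B = (Matrix.of μ).map (Nat.cast : ℕ → ℂ) := by
    ext x y
    simp [hμ]
  have hz := Complex.isPrimitiveRoot_exp L hL
  have hcop : Int.gcd ℓ L = 1 := by
    have h := hℓ.coprime.of_mul_right_right
    rw [← Int.isCoprime_iff_gcd_eq_one, hLdef]
    push_cast at h ⊢
    exact h
  obtain ⟨K, _, ζ, φ, ψ, hφ, hψ⟩ := exists_two_embeddings hz (hz.zpow_of_gcd_eq_one ℓ hcop)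
  have hφS : (Matrix.of fun x y : WReps (m + 1) p q r => pairS x.1 y.1) =
      (Matrix.of fun x y : WReps (m + 1) p q r => fieldS ζ x.1 y.1).map φ := by
    ext x y
    simp only [Matrix.of_apply, Matrix.map_apply, map_fieldS, hφ]
    exact (fieldS_exp hp hq x.1 y.1).symm
  have hψS : (Matrix.of fun x y : WReps (m + 1) p q r => wSrep x.1 y.1) =
      (Matrix.of fun x y : WReps (m + 1) p q r => fieldS ζ x.1 y.1).map ψ := by
    ext x y
    simp only [Matrix.of_apply, Matrix.map_apply, map_fieldS, hψ]
    exact (fieldS_exp_pow hp hq hℓ x.2 y.2).symm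
  rw [hBμ, hφS, hψS, natMatrix_comm_map_iff, natMatrix_comm_map_iff]

end Galois

/-! ### Matrices made of equal blocks along the orbits of `J^{-r} K` -/

section Blocks

variable {m p q : ℕ} {r : ℤ}

/-- The properties shared by all lifts of matrices indexed by the `W_N(p,q)` primaries: only weights
of equal charge are coupled, and the simple current `J^{-r} K` is a symmetry. -/
structure IsBlock (r : ℤ) (Mt : Matrix (Weight2 (m + 1) p q) (Weight2 (m + 1) p q) ℂ) : Prop where
  charge : ∀ x y, Mt x y ≠ 0 → pairCharge r x = pairCharge r y
  current : ∀ x y, Mt (JKpow (-r) 1 x) (JKpow (-r) 1 y) = Mt x y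

theorem IsBlock.current_zpow {Mt : Matrix (Weight2 (m + 1) p q) (Weight2 (m + 1) p q) ℂ}
    (h : IsBlock r Mt) (i : ℤ) (x y : Weight2 (m + 1) p q) :
    Mt (JKpow (i * r) (-i) x) (JKpow (i * r) (-i) y) = Mt x y := by
  have hstep : ∀ i : ℤ, Mt (JKpow ((i + 1) * r) (-(i + 1)) x) (JKpow ((i + 1) * r) (-(i + 1)) y) =
      Mt (JKpow (i * r) (-i) x) (JKpow (i * r) (-i) y) := by
    intro i
    rw [← h.current, JKpow_JKpow, JKpow_JKpow]
    have e1 : -r + (i + 1) * r = i * r := by ring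
    have e2 : 1 + -(i + 1) = -i := by ring
    rw [e1, e2]
  induction i using Int.induction_on with
  | zero => simp [JKpow_zero]
  | succ i ih => rw [hstep, ih]
  | pred i ih => rw [← hstep, sub_add_cancel, ih]

/-- The images of `Φ_{WN}^{p,q}` under the powers of `J^{-r} K` cover all weights. -/
theorem exists_eq_current (hg : IsUnit ((r ^ 2 * p + q : ℤ) : ZMod (m + 1)))
    (x : Weight2 (m + 1) p q) :
    ∃ a : ℕ, a < m + 1 ∧ ∃ w ∈ WReps (m + 1) p q r, x = JKpow (a * r) (-a) w := by
  obtain ⟨g, hg⟩ := hg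
  set a : ZMod (m + 1) := -pairCharge r x * ((g⁻¹ : (ZMod (m + 1))ˣ) : ZMod (m + 1)) with ha
  have hag : a * (r ^ 2 * p + q) = -pairCharge r x := by
    push_cast at hg
    rw [← hg, ha, mul_assoc, Units.inv_mul, mul_one]
  refine ⟨a.val, ZMod.val_lt a, JKpow (-(a.val) * r) (-(-(a.val : ℤ))) x, ?_, ?_⟩
  · rw [mem_WReps_iff, pairCharge_current]
    push_cast
    rw [ZMod.natCast_zmod_val]
    linear_combination hag
  · rw [JKpow_JKpow, neg_mul, add_neg_cancel, neg_neg, neg_add_cancel, JKpow_zero]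

/-- The images of `Φ_{WN}^{p,q}` under the powers of `J^{-r} K` are separated by their charges. -/
theorem current_charge_eq_iff (hg : IsUnit ((r ^ 2 * p + q : ℤ) : ZMod (m + 1)))
    {x y : Weight2 (m + 1) p q} (hx : x ∈ WReps (m + 1) p q r) (hy : y ∈ WReps (m + 1) p q r)
    (a b : ℤ) : pairCharge r (JKpow (a * r) (-a) x) = pairCharge r (JKpow (b * r) (-b) y) ↔
      (a : ZMod (m + 1)) = b := by
  rw [pairCharge_current, pairCharge_current, mem_WReps_iff.mp hx, mem_WReps_iff.mp hy,
    sub_right_inj]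
  push_cast at hg
  exact hg.mul_left_inj

theorem natCast_zmod_inj {n a b : ℕ} (ha : a < n) (hb : b < n) (h : (a : ZMod n) = b) : a = b := by
  rw [ZMod.natCast_eq_natCast_iff'] at h
  rwa [Nat.mod_eq_of_lt ha, Nat.mod_eq_of_lt hb] at h

theorem IsLift.eq {M : Matrix (WPrimary (m + 1) p q) (WPrimary (m + 1) p q) ℂ}
    {Mt : Matrix (Weight2 (m + 1) p q) (Weight2 (m + 1) p q) ℂ} (h : IsLift r M Mt)
    {x y : Weight2 (m + 1) p q} (hx : x ∈ WReps (m + 1) p q r) (hy : y ∈ WReps (m + 1) p q r) :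
    Mt x y = M (orbit x) (orbit y) := by
  have := h x hx y hy 0 0 (Nat.succ_pos m) (Nat.succ_pos m)
  simpa [JKpow_zero] using this

theorem IsLift.isBlock (hg : IsUnit ((r ^ 2 * p + q : ℤ) : ZMod (m + 1)))
    {M : Matrix (WPrimary (m + 1) p q) (WPrimary (m + 1) p q) ℂ}
    {Mt : Matrix (Weight2 (m + 1) p q) (Weight2 (m + 1) p q) ℂ} (h : IsLift r M Mt) :
    IsBlock r Mt := by
  -- the defining formula of a lift extends to all integers `a`, `b`
  have hint : ∀ x ∈ WReps (m + 1) p q r, ∀ y ∈ WReps (m + 1) p q r, ∀ a b : ℤ,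
      Mt (JKpow (a * r) (-a) x) (JKpow (b * r) (-b) y) =
        if (a : ZMod (m + 1)) = b then M (orbit x) (orbit y) else 0 := by
    intro x hx y hy a b
    have e : ∀ (a : ℤ) (x : Weight2 (m + 1) p q), JKpow (a * r) (-a) x =
        JKpow (((a : ZMod (m + 1)).val : ℤ) * r) (-((a : ZMod (m + 1)).val : ℤ)) x := by
      intro a x
      refine JKpow_congr ?_ ?_ x <;> push_cast <;> rw [ZMod.natCast_zmod_val]
    rw [e a, e b, h x hx y hy _ _ (ZMod.val_lt _) (ZMod.val_lt _)]
    simp only [(ZMod.val_injective (m + 1)).eq_iff]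
  constructor
  · intro x y hxy
    obtain ⟨a, -, w, hw, rfl⟩ := exists_eq_current hg x
    obtain ⟨b, -, w', hw', rfl⟩ := exists_eq_current hg y
    rw [current_charge_eq_iff hg hw hw']
    rw [hint w hw w' hw'] at hxy
    by_contra hne
    exact hxy (if_neg hne)
  · intro x y
    obtain ⟨a, -, w, hw, rfl⟩ := exists_eq_current hg x
    obtain ⟨b, -, w', hw', rfl⟩ := exists_eq_current hg y
    have e : ∀ (a : ℤ) (x : Weight2 (m + 1) p q), JKpow (-r) 1 (JKpow (a * r) (-a) x) =
        JKpow ((a - 1) * r) (-(a - 1)) x := by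
      intro a x
      rw [JKpow_JKpow]
      congr 1 <;> ring
    rw [e, e, hint w hw w' hw', hint w hw w' hw']
    push_cast
    simp only [sub_left_inj]

theorem IsBlock.isLift (hg : IsUnit ((r ^ 2 * p + q : ℤ) : ZMod (m + 1)))
    {M : Matrix (WPrimary (m + 1) p q) (WPrimary (m + 1) p q) ℂ}
    {Mt : Matrix (Weight2 (m + 1) p q) (Weight2 (m + 1) p q) ℂ} (h : IsBlock r Mt)
    (hM : ∀ x ∈ WReps (m + 1) p q r, ∀ y ∈ WReps (m + 1) p q r, Mt x y = M (orbit x) (orbit y)) :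
    IsLift r M Mt := by
  intro x hx y hy a b ha hb
  split_ifs with hab
  · subst hab
    rw [h.current_zpow, hM x hx y hy]
  · by_contra hne
    have := (current_charge_eq_iff hg hx hy a b).mp (h.charge _ _ hne)
    exact hab (natCast_zmod_inj ha hb (by exact_mod_cast this))

theorem existsUnique_isLift (hg : IsUnit ((r ^ 2 * p + q : ℤ) : ZMod (m + 1)))
    (M : Matrix (WPrimary (m + 1) p q) (WPrimary (m + 1) p q) ℂ) :
    ∃! Mt : Matrix (Weight2 (m + 1) p q) (Weight2 (m + 1) p q) ℂ, IsLift r M Mt := by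
  choose a ha w hw haw using exists_eq_current (p := p) (q := q) hg
  refine ⟨Matrix.of fun x y => if a x = a y then M (orbit (w x)) (orbit (w y)) else 0, ?_, ?_⟩
  · intro x hx y hy b c hb hc
    have key : ∀ x ∈ WReps (m + 1) p q r, ∀ b < m + 1, a (JKpow (b * r) (-b) x) = b ∧
        w (JKpow (b * r) (-b) x) = x := by
      intro x hx b hb
      set y := JKpow (b * r) (-b) x with hy
      have h1 : a y = b := by
        have h2 := (current_charge_eq_iff hg (hw y) hx (a y) b).mp (by rw [← haw y])
        exact natCast_zmod_inj (ha y) hb (by exact_mod_cast h2)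
      refine ⟨h1, ?_⟩
      have h2 := haw y
      rw [h1, hy] at h2
      exact ((JKperm (m + 1) p q (b * r) (-b)).injective h2).symm
    rw [Matrix.of_apply, (key x hx b hb).1, (key x hx b hb).2, (key y hy c hc).1,
      (key y hy c hc).2]
  · intro Mt hMt
    ext x y
    rw [Matrix.of_apply, ← hMt (w x) (hw x) (w y) (hw y) (a x) (a y) (ha x) (ha y), ← haw x,
      ← haw y]

/-! ### Restriction to `Φ_{WN}^{p,q}` -/

noncomputable instance : Fintype (WReps (m + 1) p q r) := Fintype.ofFinite _

theorem sum_eq_sum_WReps {f : Weight2 (m + 1) p q → ℂ}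
    (hf : ∀ x, x ∉ WReps (m + 1) p q r → f x = 0) :
    ∑ x, f x = ∑ w : WReps (m + 1) p q r, f w := by
  refine (Finset.sum_of_injOn Subtype.val Subtype.val_injective.injOn
    (fun _ _ => Finset.mem_coe.mpr (Finset.mem_univ _)) (fun x _ hx => hf x fun h => hx ?_)
    fun _ _ => rfl).symm
  exact ⟨⟨x, h⟩, by simp, rfl⟩

theorem pairS_current (hp : p ≠ 0) (hq : q ≠ 0) (i : ℤ) (x y : Weight2 (m + 1) p q) :
    pairS (JKpow (i * r) (-i) x) y =
      (((-1 : ℂ) ^ m) ^ (1 - r) * ZMod.stdAddChar (pairCharge r y)) ^ (-i) * pairS x y := by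
  have e : i * r = -r * -i := by ring
  rw [pairS_JKpow hp hq, ← suCharge_zpow_mul, mul_zpow, ← zpow_mul, ← zpow_mul, one_mul, e]

/-- On the images of `Φ_{WN}^{p,q}` under powers of `J^{-r} K`, the matrix `S` is a multiple of its
restriction to `Φ_{WN}^{p,q}`. -/
theorem exists_pairS_current_current (hp : p ≠ 0) (hq : q ≠ 0) (r i j : ℤ) :
    ∃ F : ℂ, F ≠ 0 ∧ ∀ x ∈ WReps (m + 1) p q r, ∀ y ∈ WReps (m + 1) p q r,
      pairS (JKpow (i * r) (-i) x) (JKpow (j * r) (-j) y) = F * pairS x y := by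
  have h1 : ((-1 : ℂ) ^ m) ^ (1 - r) ≠ 0 :=
    zpow_ne_zero _ (pow_ne_zero _ (neg_ne_zero.mpr one_ne_zero))
  refine ⟨(((-1 : ℂ) ^ m) ^ (1 - r) *
      ZMod.stdAddChar ((0 : ZMod (m + 1)) - (j : ZMod (m + 1)) *
        ((r : ZMod (m + 1)) ^ 2 * (p : ZMod (m + 1)) + (q : ZMod (m + 1))))) ^ (-i) *
      (((-1 : ℂ) ^ m) ^ (1 - r) * ZMod.stdAddChar (0 : ZMod (m + 1))) ^ (-j), ?_, ?_⟩
  · exact mul_ne_zero (zpow_ne_zero _ (mul_ne_zero h1 (stdAddChar_ne_zero _)))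
      (zpow_ne_zero _ (mul_ne_zero h1 (stdAddChar_ne_zero _)))
  · intro x hx y hy
    rw [pairS_current hp hq, pairS_comm, pairS_current hp hq, pairCharge_current,
      mem_WReps_iff.mp hx, mem_WReps_iff.mp hy, pairS_comm y x, mul_assoc]

/-- Commutation with `S` may be tested on `Φ_{WN}^{p,q}`: both products split into blocks that are
nonzero multiples of the products of the restricted matrices. -/
theorem IsBlock.S_comm_iff (hp : p ≠ 0) (hq : q ≠ 0)
    (hg : IsUnit ((r ^ 2 * p + q : ℤ) : ZMod (m + 1)))
    {Mt : Matrix (Weight2 (m + 1) p q) (Weight2 (m + 1) p q) ℂ} (h : IsBlock r Mt) :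
    pairMatrixS m p q * Mt = Mt * pairMatrixS m p q ↔
      (Matrix.of fun x y : WReps (m + 1) p q r => pairS x.1 y.1) *
          (Matrix.of fun x y : WReps (m + 1) p q r => Mt x.1 y.1) =
        (Matrix.of fun x y : WReps (m + 1) p q r => Mt x.1 y.1) *
          (Matrix.of fun x y : WReps (m + 1) p q r => pairS x.1 y.1) := by
  have hcharge : ∀ x y, y ∈ WReps (m + 1) p q r → x ∉ WReps (m + 1) p q r → Mt x y = 0 := by
    intro x y hy hx
    by_contra hne
    exact hx (mem_WReps_iff.mpr ((h.charge x y hne).trans (mem_WReps_iff.mp hy)))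
  have hcharge' : ∀ x y, x ∈ WReps (m + 1) p q r → y ∉ WReps (m + 1) p q r → Mt x y = 0 := by
    intro x y hx hy
    by_contra hne
    exact hy (mem_WReps_iff.mpr ((h.charge x y hne).symm.trans (mem_WReps_iff.mp hx)))
  have key : ∀ i j : ℤ, ∃ F : ℂ, F ≠ 0 ∧ ∀ x y : WReps (m + 1) p q r,
      (pairMatrixS m p q * Mt) (JKpow (i * r) (-i) x.1) (JKpow (j * r) (-j) y.1) =
        F * ((Matrix.of fun x y : WReps (m + 1) p q r => pairS x.1 y.1) *
          (Matrix.of fun x y : WReps (m + 1) p q r => Mt x.1 y.1)) x y ∧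
      (Mt * pairMatrixS m p q) (JKpow (i * r) (-i) x.1) (JKpow (j * r) (-j) y.1) =
        F * ((Matrix.of fun x y : WReps (m + 1) p q r => Mt x.1 y.1) *
          (Matrix.of fun x y : WReps (m + 1) p q r => pairS x.1 y.1)) x y := by
    intro i j
    obtain ⟨F, hF, hFS⟩ := exists_pairS_current_current (m := m) hp hq r i j
    refine ⟨F, hF, fun x y => ⟨?_, ?_⟩⟩
    · rw [Matrix.mul_apply, ← Equiv.sum_comp (JKperm (m + 1) p q (j * r) (-j))]
      simp only [JKperm_apply, h.current_zpow]
      rw [sum_eq_sum_WReps (r := r) fun z hz => by rw [hcharge z y y.2 hz, mul_zero],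
        Matrix.mul_apply, Finset.mul_sum]
      refine Finset.sum_congr rfl fun z _ => ?_
      simp only [Matrix.of_apply, pairMatrixS_apply]
      rw [hFS x x.2 z z.2, mul_assoc]
    · rw [Matrix.mul_apply, ← Equiv.sum_comp (JKperm (m + 1) p q (i * r) (-i))]
      simp only [JKperm_apply, h.current_zpow]
      rw [sum_eq_sum_WReps (r := r) fun z hz => by rw [hcharge' x z x.2 hz, zero_mul],
        Matrix.mul_apply, Finset.mul_sum]
      refine Finset.sum_congr rfl fun z _ => ?_
      simp only [Matrix.of_apply, pairMatrixS_apply]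
      rw [hFS z z.2 y y.2]
      ring
  constructor
  · intro hcomm
    obtain ⟨F, hF, hFk⟩ := key 0 0
    ext x y
    have h1 := hFk x y
    rw [hcomm] at h1
    exact mul_left_cancel₀ hF (h1.1.symm.trans h1.2)
  · intro hcomm
    ext x y
    obtain ⟨a, -, w, hw, rfl⟩ := exists_eq_current hg x
    obtain ⟨b, -, w', hw', rfl⟩ := exists_eq_current hg y
    obtain ⟨F, hF, hFk⟩ := key a b
    have h1 := hFk ⟨w, hw⟩ ⟨w', hw'⟩
    rw [h1.1, h1.2, hcomm]

theorem pairT_current_zpow_eq_iff (hp : p ≠ 0) (hq : q ≠ 0) (i : ℤ) {x y : Weight2 (m + 1) p q}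
    (h : pairCharge r x = pairCharge r y) :
    pairT (JKpow (i * r) (-i) x) = pairT (JKpow (i * r) (-i) y) ↔ pairT x = pairT y := by
  have hstep : ∀ i : ℤ, (pairT (JKpow ((i + 1) * r) (-(i + 1)) x) =
      pairT (JKpow ((i + 1) * r) (-(i + 1)) y)) ↔
      (pairT (JKpow (i * r) (-i) x) = pairT (JKpow (i * r) (-i) y)) := by
    intro i
    have h1 : pairCharge r (JKpow ((i + 1) * r) (-(i + 1)) x) =
        pairCharge r (JKpow ((i + 1) * r) (-(i + 1)) y) := by
      rw [pairCharge_current, pairCharge_current, h]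
    rw [← pairT_current_eq_iff hp hq r h1, JKpow_JKpow, JKpow_JKpow]
    have e1 : -r + (i + 1) * r = i * r := by ring
    have e2 : 1 + -(i + 1) = -i := by ring
    rw [e1, e2]
  induction i using Int.induction_on with
  | zero => simp [JKpow_zero]
  | succ i ih => exact (hstep i).trans ih
  | pred i ih =>
    have h1 := hstep (-(i : ℤ) - 1)
    rw [sub_add_cancel] at h1
    exact h1.symm.trans ih

theorem IsBlock.T_comm_iff (hp : p ≠ 0) (hq : q ≠ 0)
    (hg : IsUnit ((r ^ 2 * p + q : ℤ) : ZMod (m + 1)))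
    {Mt : Matrix (Weight2 (m + 1) p q) (Weight2 (m + 1) p q) ℂ} (h : IsBlock r Mt) :
    (∀ x y, Mt x y ≠ 0 → pairT x = pairT y) ↔
      ∀ x ∈ WReps (m + 1) p q r, ∀ y ∈ WReps (m + 1) p q r, Mt x y ≠ 0 → pairT x = pairT y := by
  refine ⟨fun h1 x _ y _ => h1 x y, fun h1 x y hxy => ?_⟩
  obtain ⟨a, -, w, hw, rfl⟩ := exists_eq_current hg x
  obtain ⟨b, -, w', hw', hy⟩ := exists_eq_current hg y
  have hab : (a : ZMod (m + 1)) = b := by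
    have h2 := h.charge _ _ hxy
    rw [hy, current_charge_eq_iff hg hw hw'] at h2
    exact_mod_cast h2
  have hy' : y = JKpow (a * r) (-a) w' := by
    rw [hy]
    refine JKpow_congr ?_ ?_ w' <;> push_cast <;> rw [hab]
  rw [hy'] at hxy ⊢
  rw [h.current_zpow] at hxy
  rw [pairT_current_zpow_eq_iff hp hq _
    ((mem_WReps_iff.mp hw).trans (mem_WReps_iff.mp hw').symm)]
  exact h1 w hw w' hw' hxy

/-! ### The orbits of `JK` -/

theorem orbit_eq_iff {N : ℕ} {x y : Weight2 N p q} :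
    orbit x = orbit y ↔ ∃ i : ℤ, JKpow i i x = y := by
  refine (Quotient.eq (r := Equiv.Perm.SameCycle.setoid (JK N p q))).trans ?_
  simp only [← JK_zpow_apply]
  rfl

/-- Every `JK`-orbit meets `Φ_{WN}^{p,q}` in exactly one weight. -/
theorem orbit_bijective (hd : IsUnit ((r * p - q : ℤ) : ZMod (m + 1))) :
    Function.Bijective fun w : WReps (m + 1) p q r => orbit w.1 := by
  have hcharge : ∀ (i : ℤ) (x : Weight2 (m + 1) p q), pairCharge r (JKpow i i x) =
      pairCharge r x - i * ((r * p - q : ℤ) : ZMod (m + 1)) := by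
    intro i x
    rw [pairCharge_JKpow]
    push_cast
    ring
  constructor
  · rintro ⟨x, hx⟩ ⟨y, hy⟩ h
    obtain ⟨i, hi⟩ := orbit_eq_iff.mp h
    have h1 := hcharge i x
    rw [hi, mem_WReps_iff.mp hx, mem_WReps_iff.mp hy, zero_sub, eq_comm, neg_eq_zero,
      hd.mul_left_eq_zero] at h1
    have hi' : JKpow i i x = y := hi
    rw [Subtype.mk.injEq, ← hi', JKpow_congr (i' := 0) (j' := 0) (by simpa using h1)
      (by simpa using h1), JKpow_zero]
  · intro X
    obtain ⟨x, rfl⟩ := Quotient.exists_rep X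
    obtain ⟨d, hd⟩ := hd
    set i : ZMod (m + 1) := pairCharge r x * ((d⁻¹ : (ZMod (m + 1))ˣ) : ZMod (m + 1)) with hi
    refine ⟨⟨JKpow i.val i.val x, ?_⟩, (orbit_eq_iff.mpr ⟨i.val, rfl⟩).symm⟩
    rw [mem_WReps_iff, hcharge, ← hd, Int.cast_natCast, ZMod.natCast_zmod_val, hi, mul_assoc,
      Units.inv_mul, mul_one, sub_self]

theorem wS_comm_iff (hp : m + 1 < p) (hq : m + 1 < q)
    (hd : IsUnit ((r * p - q : ℤ) : ZMod (m + 1))) {α' : ℂ} (hα' : α' ≠ 0)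
    (M : Matrix (WPrimary (m + 1) p q) (WPrimary (m + 1) p q) ℂ) :
    wS (m + 1) p q hp hq α' * M = M * wS (m + 1) p q hp hq α' ↔
      (Matrix.of fun x y : WReps (m + 1) p q r => wSrep x.1 y.1) *
          (Matrix.of fun x y : WReps (m + 1) p q r => M (orbit x.1) (orbit y.1)) =
        (Matrix.of fun x y : WReps (m + 1) p q r => M (orbit x.1) (orbit y.1)) *
          (Matrix.of fun x y : WReps (m + 1) p q r => wSrep x.1 y.1) := by
  set e := Equiv.ofBijective _ (orbit_bijective (p := p) (q := q) hd) with he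
  have h1 : (wS (m + 1) p q hp hq α').submatrix e e =
      α' • (Matrix.of fun x y : WReps (m + 1) p q r => wSrep x.1 y.1) := rfl
  have h2 : M.submatrix e e =
      Matrix.of fun x y : WReps (m + 1) p q r => M (orbit x.1) (orbit y.1) := rfl
  have h3 : ∀ A B : Matrix (WPrimary (m + 1) p q) (WPrimary (m + 1) p q) ℂ,
      A = B ↔ A.submatrix e e = B.submatrix e e := fun A B =>
    ((Matrix.reindex e.symm e.symm).injective.eq_iff (a := A) (b := B)).symm
  rw [h3, ← Matrix.submatrix_mul_equiv _ _ e e e, ← Matrix.submatrix_mul_equiv _ _ e e e, h1, h2,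
    Matrix.smul_mul, Matrix.mul_smul]
  exact (smul_right_injective _ hα').eq_iff

theorem wT_comm_iff (hd : IsUnit ((r * p - q : ℤ) : ZMod (m + 1))) {β' : ℂ} (hβ' : β' ≠ 0)
    (M : Matrix (WPrimary (m + 1) p q) (WPrimary (m + 1) p q) ℂ) :
    wT (m + 1) p q β' * M = M * wT (m + 1) p q β' ↔
      ∀ x ∈ WReps (m + 1) p q r, ∀ y ∈ WReps (m + 1) p q r,
        M (orbit x) (orbit y) ≠ 0 → wTrep x = wTrep y := by
  unfold wT
  rw [diagonal_comm_iff hβ']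
  refine ⟨fun h x _ y _ => h (orbit x) (orbit y), fun h X Y => ?_⟩
  obtain ⟨x, rfl⟩ := (orbit_bijective (p := p) (q := q) hd).surjective X
  obtain ⟨y, rfl⟩ := (orbit_bijective (p := p) (q := q) hd).surjective Y
  exact h x.1 x.2 y.1 y.2

end Blocks

/-! ### Matching the invariants -/

section Vacuum

variable {m p q : ℕ} {r : ℤ}

theorem Admissible.isUnit_sub {N : ℕ} [NeZero N] (hr : Admissible N p q r) :
    IsUnit ((r * p - q : ℤ) : ZMod N) :=
  (ZMod.coe_int_isUnit_iff_isCoprime _ _).mpr hr.1.of_mul_right_right.symm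

theorem Admissible.isUnit_add {N : ℕ} [NeZero N] (hr : Admissible N p q r) :
    IsUnit ((r ^ 2 * p + q : ℤ) : ZMod N) :=
  (ZMod.coe_int_isUnit_iff_isCoprime _ _).mpr hr.2.of_mul_right_right.symm

theorem pairMatrixS_transpose : (pairMatrixS m p q).transpose = pairMatrixS m p q := by
  ext x y
  exact pairS_comm y x

theorem unitarity_const_ne_zero (hp : p ≠ 0) (hq : q ≠ 0) :
    ((((m + 1 : ℕ) : ℂ) * (p : ℂ) ^ m) * (((m + 1 : ℕ) : ℂ) * (q : ℂ) ^ m)) ≠ 0 := by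
  have hm : ((m + 1 : ℕ) : ℂ) ≠ 0 := by exact_mod_cast Nat.succ_ne_zero m
  have hpC : (p : ℂ) ≠ 0 := by exact_mod_cast hp
  have hqC : (q : ℂ) ≠ 0 := by exact_mod_cast hq
  exact mul_ne_zero (mul_ne_zero hm (pow_ne_zero _ hpC)) (mul_ne_zero hm (pow_ne_zero _ hqC))

/-- A matrix of equal blocks commutes with the modular data of `SU(N) × SU(N)` if and only if the
block, read on the `W_N(p,q)` primaries, commutes with the modular data of `W_N(p,q)`. -/
theorem IsBlock.comm_iff (hp : m + 1 < p) (hq : m + 1 < q) (hpq : Nat.Coprime p q)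
    (hr : Admissible (m + 1) p q r) {αp αq βp βq α' β' : ℂ} (hαp : αp ≠ 0) (hαq : αq ≠ 0)
    (hβp : βp ≠ 0) (hβq : βq ≠ 0) (hα' : α' ≠ 0) (hβ' : β' ≠ 0)
    {M : Matrix (WPrimary (m + 1) p q) (WPrimary (m + 1) p q) ℂ}
    {Mt : Matrix (Weight2 (m + 1) p q) (Weight2 (m + 1) p q) ℂ} (h : IsBlock r Mt)
    (hnat : ∀ x y, ∃ k : ℕ, M x y = k)
    (hM : ∀ x ∈ WReps (m + 1) p q r, ∀ y ∈ WReps (m + 1) p q r, Mt x y = M (orbit x) (orbit y)) :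
    (S2 (m + 1) p q βp βq * Mt = Mt * S2 (m + 1) p q βp βq ∧
      T2 (m + 1) p q αp αq * Mt = Mt * T2 (m + 1) p q αp αq) ↔
    (wS (m + 1) p q hp hq α' * M = M * wS (m + 1) p q hp hq α' ∧
      wT (m + 1) p q β' * M = M * wT (m + 1) p q β') := by
  have hp0 : p ≠ 0 := by omega
  have hq0 : q ≠ 0 := by omega
  obtain ⟨ℓ, hℓ⟩ := exists_isGaloisExponent hpq hr
  have hB : (Matrix.of fun x y : WReps (m + 1) p q r => Mt x.1 y.1) =
      Matrix.of fun x y : WReps (m + 1) p q r => M (orbit x.1) (orbit y.1) := by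
    ext x y
    exact hM x x.2 y y.2
  rw [S2_comm_iff hβp hβq, T2_comm_iff hαp hαq, wS_comm_iff hp hq hr.isUnit_sub hα',
    wT_comm_iff hr.isUnit_sub hβ', h.S_comm_iff hp0 hq0 hr.isUnit_add,
    h.T_comm_iff hp0 hq0 hr.isUnit_add, hB,
    wSrep_comm_iff hp0 hq0 hℓ
      (Matrix.of fun x y : WReps (m + 1) p q r => M (orbit x.1) (orbit y.1))
      fun x y => hnat (orbit x.1) (orbit y.1)]
  refine and_congr_right fun _ => forall₂_congr fun x hx => forall₂_congr fun y hy => ?_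
  rw [hM x hx y hy, wTrep_eq_iff hp0 hq0 hℓ hx hy]

/-- A matrix commuting with `S` whose diagonal entries at `ρρ` and `J^{-r}ρ Kρ` are one is made of
equal blocks along the orbits of `J^{-r} K`. -/
theorem isBlock_of_vacuum (hN : 2 ≤ m + 1) (hp : m + 1 < p) (hq : m + 1 < q)
    {Mt : Matrix (Weight2 (m + 1) p q) (Weight2 (m + 1) p q) ℂ}
    (hnat : ∀ x y, ∃ k : ℕ, Mt x y = k)
    (hS : pairMatrixS m p q * Mt = Mt * pairMatrixS m p q)
    (h0 : Mt (vacuum2 hN hp hq) (vacuum2 hN hp hq) = 1)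
    (h1 : Mt (JKpow (-r) 1 (vacuum2 hN hp hq)) (JKpow (-r) 1 (vacuum2 hN hp hq)) = 1) :
    IsBlock r Mt := by
  have hp0 : p ≠ 0 := by omega
  have hq0 : q ≠ 0 := by omega
  have hC := unitarity_const_ne_zero (m := m) hp0 hq0
  have hU := pairS_mul_conjTranspose (m := m) hp0 hq0
  obtain ⟨c, hc, hcs⟩ := exists_suS_rho hN hp
  obtain ⟨d, hd, hds⟩ := exists_suS_rho hN hq
  choose s hs hs' using hcs
  choose t ht ht' using hds
  set ε : ℂ := ((-1 : ℂ) ^ m) ^ (1 - r) with hε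
  set θ : Weight2 (m + 1) p q → ℂ := fun y => ε * ZMod.stdAddChar (pairCharge r y) with hθ
  have hε0 : ε ≠ 0 := zpow_ne_zero _ (pow_ne_zero _ (neg_ne_zero.mpr one_ne_zero))
  have hθ1 : ∀ y, ‖θ y‖ = 1 := by
    intro y
    rw [hθ]
    simp only
    rw [norm_mul, ZMod.stdAddChar_apply, Circle.norm_coe, hε, norm_zpow, norm_pow, norm_neg,
      norm_one, one_pow, one_zpow, mul_one]
  have hθ0 : ∀ y, θ y ≠ 0 := fun y => norm_ne_zero_iff.mp (by rw [hθ1]; exact one_ne_zero)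
  have hj : ∀ x y, pairMatrixS m p q (JKperm (m + 1) p q (-r) 1 x) y =
      θ y * pairMatrixS m p q x y := by
    intro x y
    rw [JKperm_apply, pairMatrixS_apply, pairMatrixS_apply, pairS_JKpow hp0 hq0,
      suCharge_zpow_mul]
  have hcharge : ∀ x y, Mt x y ≠ 0 → θ x = θ y := fun x y hxy =>
    simpleCurrent_charge_eq hC hU pairMatrixS_transpose hS hnat hθ1 hj (v := vacuum2 hN hp hq)
      (c := c * d) (mul_ne_zero hc hd) (s := fun y => s y.1 * t y.2)
      (fun y => mul_pos (hs _) (ht _)) (fun y => by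
        rw [pairMatrixS_apply, pairS, vacuum2, hs', ht']
        push_cast
        ring) h0 h1 hxy
  refine ⟨fun x y hxy => ?_, fun x y => ?_⟩
  · exact ZMod.injective_stdAddChar (mul_left_cancel₀ hε0 (hcharge x y hxy))
  · exact apply_simpleCurrent_eq hC hU hS hθ0 hj hcharge x y

/-- If `N` and `r` are even, equality of the charges and of the entries of `T` implies equality of
the `N`-alities of the first components modulo two. -/
theorem even_nality_sub (hp : p ≠ 0) (hq : q ≠ 0) (hN : Even (m + 1)) (hr : Even r)
    (hqodd : Odd (q : ℤ)) {x y : Weight2 (m + 1) p q} (hc : pairCharge r x = pairCharge r y)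
    (hT : pairT x = pairT y) : Even (nality x.1.label - nality y.1.label) := by
  obtain ⟨h, hh⟩ := hN
  have hh' : ((m + 1 : ℕ) : ℤ) = 2 * h := by
    rw [hh]
    push_cast
    ring
  rw [pairT_eq_exp hp hq, pairT_eq_exp hp hq, exp_int_div_eq_iff (by positivity)] at hT
  obtain ⟨a, ha⟩ := hT
  unfold pairCharge at hc
  rw [← Int.cast_mul, ← Int.cast_mul, ← Int.cast_sub, ← Int.cast_sub,
    ZMod.intCast_eq_intCast_iff_dvd_sub] at hc
  obtain ⟨b, hb⟩ := hc
  obtain ⟨s, hs⟩ := hr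
  unfold pairTExponent at ha
  rw [hh'] at ha hb
  have h2 : nality x.2.label - nality y.2.label =
      2 * (s * (nality x.1.label - nality y.1.label) - h * b) := by
    linear_combination -hb + (nality x.1.label - nality y.1.label) * hs
  generalize ∑ i, bracket x.1.label i ^ 2 = A at ha
  generalize ∑ i, bracket y.1.label i ^ 2 = B at ha
  generalize ∑ i, bracket x.2.label i ^ 2 = C at ha
  generalize ∑ i, bracket y.2.label i ^ 2 = D at ha
  have h3 : Even (q * ((nality x.1.label - nality y.1.label) *
      (nality x.1.label + nality y.1.label))) := by
    rw [even_iff_two_dvd]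
    refine ⟨q * h * (A - B) + p * h * (C - D) - (((m + 1) * p * q : ℕ) : ℤ) * a -
      p * (s * (nality x.1.label - nality y.1.label) - h * b) *
        (nality x.2.label + nality y.2.label), ?_⟩
    linear_combination -ha - p * (nality x.2.label + nality y.2.label) * h2
  rw [Int.even_mul, Int.even_mul] at h3
  have h4 := h3.resolve_left (Int.not_even_iff_odd.mpr hqodd)
  rw [Int.even_add, ← Int.even_sub] at h4
  exact h4.elim id id

/-- The lift and the original matrix have the same entry at the vacuum. When `N` and `r` are even,
`ρρ` does not belong to `Φ_{WN}^{p,q}`. It is then related to the representative of `[ρρ]` by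
`J^{N/2}` and a power of `J^{-r} K`, and the lift is invariant under `J^{N/2}` because it couples
only weights of equal charge and equal `T`. -/
theorem IsLift.vacuum_eq (hN : 2 ≤ m + 1) (hp : m + 1 < p) (hq : m + 1 < q)
    (hr : Admissible (m + 1) p q r)
    {M : Matrix (WPrimary (m + 1) p q) (WPrimary (m + 1) p q) ℂ}
    {Mt : Matrix (Weight2 (m + 1) p q) (Weight2 (m + 1) p q) ℂ} (h : IsLift r M Mt)
    (hS : pairMatrixS m p q * Mt = Mt * pairMatrixS m p q)
    (hT : ∀ x y, Mt x y ≠ 0 → pairT x = pairT y) :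
    Mt (vacuum2 hN hp hq) (vacuum2 hN hp hq) =
      M (orbit (vacuum2 hN hp hq)) (orbit (vacuum2 hN hp hq)) := by
  have hp0 : p ≠ 0 := by omega
  have hq0 : q ≠ 0 := by omega
  have hblock := h.isBlock hr.isUnit_add
  set v : Weight2 (m + 1) p q := vacuum2 hN hp hq with hv
  have ht : nality v.2.label = nality v.1.label := by
    have h1 := two_mul_nality_rho hN hp
    have h2 := two_mul_nality_rho hN hq
    have h3 : 2 * nality v.2.label = 2 * nality v.1.label := h2.trans h1.symm
    linarith
  have ht2 : 2 * nality v.1.label = ((m + 1 : ℕ) : ℤ) * m := two_mul_nality_rho hN hp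
  have hcharge : pairCharge r v = ((1 - r) * nality v.1.label : ℤ) := by
    unfold pairCharge
    rw [ht]
    push_cast
    ring
  by_cases hcase : Even (m + 1) ∧ Even r
  · obtain ⟨⟨k, hk⟩, hreven⟩ := hcase
    have hk2 : ((m + 1 : ℕ) : ℤ) = 2 * k := by
      rw [hk]
      push_cast
      ring
    have hqodd : Odd (q : ℤ) := by
      have h1 : Odd (r * p - q) := Int.isCoprime_two_right.mp hr.1.of_mul_right_left
      rw [Int.odd_sub'] at h1
      exact h1.mpr (hreven.mul_right _)
    have htk : nality v.1.label = k * m := by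
      rw [hk2] at ht2
      linarith
    set w : Weight2 (m + 1) p q := JKpow k k v with hw
    have hwmem : w ∈ WReps (m + 1) p q r := by
      rw [mem_WReps_iff, hw, pairCharge_JKpow, hcharge, htk]
      have h1 : (((k * ((1 - r) * m + q - r * p) : ℤ)) : ZMod (m + 1)) = 0 := by
        rw [ZMod.intCast_zmod_eq_zero_iff_dvd, hk2, mul_comm 2 (k : ℤ)]
        refine mul_dvd_mul_left _ (even_iff_two_dvd.mp ?_)
        have hmodd : Odd (m : ℤ) := ⟨k - 1, by push_cast at hk2; linarith⟩
        have h2 : Odd (1 - r) := odd_one.sub_even hreven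
        exact ((h2.mul hmodd).add_odd hqodd).sub (hreven.mul_right _)
      rw [← h1]
      push_cast
      ring
    have hsym : Mt (JKperm (m + 1) p q k 0 v) (JKperm (m + 1) p q k 0 v) = Mt v v := by
      refine apply_simpleCurrent_eq (unitarity_const_ne_zero (m := m) hp0 hq0)
        (pairS_mul_conjTranspose (m := m) hp0 hq0) hS
        (θ := fun y => suCharge y.1.label ^ (k : ℤ))
        (fun y => zpow_ne_zero _ (suCharge_ne_zero _)) (fun x y => ?_) (fun x y hxy => ?_) v v
      · rw [JKperm_apply, pairMatrixS_apply, pairMatrixS_apply, pairS_JKpow hp0 hq0, zpow_zero,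
          mul_one]
      · obtain ⟨s, hs⟩ := even_nality_sub hp0 hq0 ⟨k, hk⟩ hreven hqodd
          (hblock.charge x y hxy) (hT x y hxy)
        simp only [suCharge, mul_zpow, stdAddChar_zpow]
        congr 2
        rw [← Int.cast_mul, ← Int.cast_mul, ZMod.intCast_eq_intCast_iff_dvd_sub, hk2]
        exact ⟨-s, by linear_combination -(k : ℤ) * hs⟩
    have hshift : JKpow (-(k : ℤ) * r) (-(-(k : ℤ))) (JKperm (m + 1) p q k 0 v) = w := by
      rw [JKperm_apply, JKpow_JKpow, hw]
      refine JKpow_congr ?_ (by simp) v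
      rw [ZMod.intCast_eq_intCast_iff_dvd_sub, hk2]
      obtain ⟨s, hs⟩ := hreven
      exact ⟨s, by rw [hs]; ring⟩
    rw [← hsym, ← hblock.current_zpow (-(k : ℤ)), hshift, h.eq hwmem hwmem,
      orbit_eq_iff.mpr (⟨k, rfl⟩ : ∃ i : ℤ, JKpow i i v = w)]
  · have hvmem : v ∈ WReps (m + 1) p q r := by
      rw [mem_WReps_iff, hcharge, ZMod.intCast_zmod_eq_zero_iff_dvd]
      rcases Int.even_or_odd r with hre | ⟨s, hs⟩
      · have hm : Even (m : ℤ) := by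
          have h1 : ¬ Even (m + 1) := fun h1 => hcase ⟨h1, hre⟩
          rw [Nat.even_add_one, not_not] at h1
          exact_mod_cast h1
        obtain ⟨e, he⟩ := hm
        have h1 : nality v.1.label = ((m + 1 : ℕ) : ℤ) * e := by
          rw [he] at ht2
          linarith
        rw [h1]
        exact ⟨(1 - r) * e, by ring⟩
      · refine ⟨-s * m, ?_⟩
        rw [hs]
        linear_combination -s * ht2
    exact h.eq hvmem hvmem

end Vacuum

theorem IsLift.mem_SU2Invariants {m p q : ℕ} {r : ℤ} (hN : 2 ≤ m + 1) (hp : m + 1 < p)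
    (hq : m + 1 < q) (hpq : Nat.Coprime p q) (hr : Admissible (m + 1) p q r)
    {αp αq βp βq α' β' : ℂ} (hαp : αp ≠ 0) (hαq : αq ≠ 0) (hβp : βp ≠ 0) (hβq : βq ≠ 0)
    (hα' : α' ≠ 0) (hβ' : β' ≠ 0) {M : Matrix (WPrimary (m + 1) p q) (WPrimary (m + 1) p q) ℂ}
    (hM : M ∈ WInvariants (m + 1) p q hN hp hq α' β')
    {Mt : Matrix (Weight2 (m + 1) p q) (Weight2 (m + 1) p q) ℂ} (h : IsLift r M Mt) :
    Mt ∈ SU2Invariants (m + 1) p q hN hp hq αp αq βp βq := by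
  obtain ⟨hS, hT⟩ := ((h.isBlock hr.isUnit_add).comm_iff hp hq hpq hr hαp hαq hβp hβq hα' hβ'
    hM.nonneg_integral fun x hx y hy => h.eq hx hy).mpr ⟨hM.S_comm, hM.T_comm⟩
  refine ⟨?_, fun x y => ?_, hS, hT⟩
  · rw [h.vacuum_eq hN hp hq hr ((S2_comm_iff hβp hβq Mt).mp hS) ((T2_comm_iff hαp hαq Mt).mp hT)]
    exact hM.vacuum
  · obtain ⟨a, ha, w, hw, rfl⟩ := exists_eq_current hr.isUnit_add x
    obtain ⟨b, hb, w', hw', rfl⟩ := exists_eq_current hr.isUnit_add y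
    rw [h w hw w' hw' a b ha hb]
    split_ifs
    · exact hM.nonneg_integral _ _
    · exact ⟨0, by simp⟩

theorem exists_isLift_of_vacuum {m p q : ℕ} {r : ℤ} (hN : 2 ≤ m + 1) (hp : m + 1 < p)
    (hq : m + 1 < q) (hpq : Nat.Coprime p q) (hr : Admissible (m + 1) p q r)
    {αp αq βp βq α' β' : ℂ} (hαp : αp ≠ 0) (hαq : αq ≠ 0) (hβp : βp ≠ 0) (hβq : βq ≠ 0)
    (hα' : α' ≠ 0) (hβ' : β' ≠ 0)
    {Mt : Matrix (Weight2 (m + 1) p q) (Weight2 (m + 1) p q) ℂ}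
    (hMt : Mt ∈ SU2Invariants (m + 1) p q hN hp hq αp αq βp βq)
    (h1 : Mt (JKpow (-r) 1 (vacuum2 hN hp hq)) (JKpow (-r) 1 (vacuum2 hN hp hq)) = 1) :
    ∃ M ∈ WInvariants (m + 1) p q hN hp hq α' β', IsLift r M Mt := by
  have hS := (S2_comm_iff hβp hβq Mt).mp hMt.S_comm
  have hT := (T2_comm_iff hαp hαq Mt).mp hMt.T_comm
  have hblock := isBlock_of_vacuum hN hp hq hMt.nonneg_integral hS hMt.vacuum h1
  set e := Equiv.ofBijective _ (orbit_bijective (p := p) (q := q) (r := r) hr.isUnit_sub) with he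
  set M : Matrix (WPrimary (m + 1) p q) (WPrimary (m + 1) p q) ℂ :=
    Matrix.of fun X Y => Mt (e.symm X).1 (e.symm Y).1 with hM
  have hMe : ∀ x ∈ WReps (m + 1) p q r, ∀ y ∈ WReps (m + 1) p q r,
      Mt x y = M (orbit x) (orbit y) := by
    intro x hx y hy
    have h2 : ∀ x (hx : x ∈ WReps (m + 1) p q r), e.symm (orbit x) = ⟨x, hx⟩ := fun x hx =>
      e.symm_apply_apply ⟨x, hx⟩
    rw [hM, Matrix.of_apply, h2 x hx, h2 y hy]
  have hlift := hblock.isLift hr.isUnit_add hMe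
  have hnat : ∀ X Y, ∃ k : ℕ, M X Y = k := fun X Y => hMt.nonneg_integral _ _
  obtain ⟨hS', hT'⟩ := (hblock.comm_iff hp hq hpq hr hαp hαq hβp hβq hα' hβ' hnat hMe).mp
    ⟨hMt.S_comm, hMt.T_comm⟩
  exact ⟨M, ⟨by rw [← hlift.vacuum_eq hN hp hq hr hS hT]; exact hMt.vacuum, hnat, hS', hT'⟩, hlift⟩

theorem IsLift.unique {m p q : ℕ} {r : ℤ} (hr : Admissible (m + 1) p q r)
    {M M' : Matrix (WPrimary (m + 1) p q) (WPrimary (m + 1) p q) ℂ}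
    {Mt : Matrix (Weight2 (m + 1) p q) (Weight2 (m + 1) p q) ℂ} (h : IsLift r M Mt)
    (h' : IsLift r M' Mt) : M = M' := by
  ext X Y
  obtain ⟨x, rfl⟩ := (orbit_bijective (p := p) (q := q) hr.isUnit_sub).surjective X
  obtain ⟨y, rfl⟩ := (orbit_bijective (p := p) (q := q) hr.isUnit_sub).surjective Y
  exact (h.eq x.2 y.2).symm.trans (h'.eq x.2 y.2)

end WNModular

theorem theorem3p1 (N p q : ℕ) (hN : 2 ≤ N) (hp : N < p) (hq : N < q) (hpq : Nat.Coprime p q)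
    (r : ℤ) (hr : Admissible N p q r)
    (αp αq βp βq α' β' : ℂ) (hαp : αp ≠ 0) (hαq : αq ≠ 0) (hβp : βp ≠ 0) (hβq : βq ≠ 0)
    (hα' : α' ≠ 0) (hβ' : β' ≠ 0) :
    -- the lift of a `W_N(p,q)` invariant is well defined and is an `SU(N) × SU(N)` invariant
    (∀ M ∈ WInvariants N p q hN hp hq α' β',
      (∃! Mt, IsLift r M Mt) ∧
      ∀ Mt, IsLift r M Mt → Mt ∈ SU2Invariants N p q hN hp hq αp αq βp βq) ∧
    -- an `SU(N) × SU(N)` invariant is a lift iff its entry at `J^{-r}ρ Kρ, J^{-r}ρ Kρ` is one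
    (∀ Mt ∈ SU2Invariants N p q hN hp hq αp αq βp βq,
      (∃ M ∈ WInvariants N p q hN hp hq α' β', IsLift r M Mt) ↔
        Mt (JKpow (-r) 1 (vacuum2 hN hp hq)) (JKpow (-r) 1 (vacuum2 hN hp hq)) = 1) ∧
    -- the `W_N(p,q)` invariant is then unique
    (∀ Mt ∈ SU2Invariants N p q hN hp hq αp αq βp βq,
      ∀ M ∈ WInvariants N p q hN hp hq α' β', ∀ M' ∈ WInvariants N p q hN hp hq α' β',
        IsLift r M Mt → IsLift r M' Mt → M = M') ∧
    -- the resulting bijection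
    (∃ e : {M // M ∈ WInvariants N p q hN hp hq α' β'} ≃
        {Mt // Mt ∈ SU2Invariants N p q hN hp hq αp αq βp βq ∧
          Mt (JKpow (-r) 1 (vacuum2 hN hp hq)) (JKpow (-r) 1 (vacuum2 hN hp hq)) = 1},
      ∀ M, IsLift r M.1 (e M).1) := by
  obtain ⟨m, rfl⟩ : ∃ m, N = m + 1 := ⟨N - 1, by omega⟩
  have hlift : ∀ M, ∃! Mt, IsLift (p := p) (q := q) r M Mt :=
    existsUnique_isLift hr.isUnit_add
  have hmem : ∀ M ∈ WInvariants (m + 1) p q hN hp hq α' β', ∀ Mt, IsLift r M Mt →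
      Mt ∈ SU2Invariants (m + 1) p q hN hp hq αp αq βp βq := fun M hM Mt h =>
    h.mem_SU2Invariants hN hp hq hpq hr hαp hαq hβp hβq hα' hβ' hM
  have hone : ∀ M ∈ WInvariants (m + 1) p q hN hp hq α' β', ∀ Mt, IsLift r M Mt →
      Mt (JKpow (-r) 1 (vacuum2 hN hp hq)) (JKpow (-r) 1 (vacuum2 hN hp hq)) = 1 :=
    fun M hM Mt h => ((h.isBlock hr.isUnit_add).current _ _).trans (hmem M hM Mt h).vacuum
  have hex : ∀ Mt ∈ SU2Invariants (m + 1) p q hN hp hq αp αq βp βq,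
      Mt (JKpow (-r) 1 (vacuum2 hN hp hq)) (JKpow (-r) 1 (vacuum2 hN hp hq)) = 1 →
      ∃ M ∈ WInvariants (m + 1) p q hN hp hq α' β', IsLift r M Mt := fun Mt hMt h =>
    exists_isLift_of_vacuum hN hp hq hpq hr hαp hαq hβp hβq hα' hβ' hMt h
  refine ⟨fun M hM => ⟨hlift M, hmem M hM⟩, fun Mt hMt => ⟨?_, hex Mt hMt⟩,
    fun Mt _ M _ M' _ h h' => h.unique hr h', ?_⟩
  · rintro ⟨M, hM, h⟩
    exact hone M hM Mt h
  · choose L hL hLuniq using hlift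
    refine ⟨Equiv.ofBijective (fun M => ⟨L M.1, hmem M.1 M.2 _ (hL M.1), hone M.1 M.2 _ (hL M.1)⟩)
      ⟨fun M M' h => ?_, fun Mt => ?_⟩, fun M => hL M.1⟩
    · have h1 : L M.1 = L M'.1 := congrArg Subtype.val h
      have h2 := hL M.1
      rw [h1] at h2
      exact Subtype.ext (h2.unique hr (hL M'.1))
    · obtain ⟨M, hM, h⟩ := hex Mt.1 Mt.2.1 Mt.2.2
      exact ⟨⟨M, hM⟩, Subtype.ext (hLuniq M Mt.1 h).symm⟩
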